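/- Let $N\ge 3$ be an integer, let $p>1$ and $\gamma\ge 0$. Let $\mathcal G$ be the star graph consisting of $N$ half-lines $[0,\infty)$ glued at $0$. A function on $\mathcal G$ is written $\boldsymbol f=(f_k)_{k=1}^N$ with $f_k:[0,\infty)\to\mathbb C$, and $\|\boldsymbol f\|_{L^q(\mathcal G)}^q=\sum_{k=1}^N\|f_k\|_{L^q(0,\infty)}^q$, $\partial_x\boldsymbol f=(f_k')_{k=1}^N$. Let $H^1_c(\mathcal G)$ be the set of those $\boldsymbol f$ with $f_k\in H^1(0,\infty)$ for all $k$ (continuous representatives) and $f_1(0)=\dots=f_N(0)$, and for such $\boldsymbol f$ put $$\|\boldsymbol f\|_{\dot H^1_\gamma(\mathcal G)}=\bigl(\|\partial_x\boldsymbol f\|_{L^2(\mathcal G)}^2+N\gamma|f_1(0)|^2\bigr)^{1/2}.$$ Let $C_{\mathrm{GN}}(\gamma)$ and $C_{\mathrm{GN}}^{\mathrm{line}}$ be the best (that is, least) constants in the Gagliardo–Nirenberg inequalities $$\|\boldsymbol f\|_{L^{p+1}(\mathcal G)}^{p+1}\le C_{\mathrm{GN}}(\gamma)\,\|\boldsymbol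 f\|_{L^2(\mathcal G)}^{\frac{p+3}{2}}\|\boldsymbol f\|_{\dot H^1_\gamma(\mathcal G)}^{\frac{p-1}{2}}\qquad(\boldsymbol f\in H^1_c(\mathcal G)),$$ $$\|g\|_{L^{p+1}(\mathbb R)}^{p+1}\le C_{\mathrm{GN}}^{\mathrm{line}}\,\|g\|_{L^2(\mathbb R)}^{\frac{p+3}{2}}\|\partial_xg\|_{L^2(\mathbb R)}^{\frac{p-1}{2}}\qquad(g\in H^1(\mathbb R;\mathbb C)).$$ Then both best constants exist as finite numbers, and $C_{\mathrm{GN}}(\gamma)=C_{\mathrm{GN}}^{\mathrm{line}}$. -/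

import Mathlib

open MeasureTheory Set
open scoped ENNReal NNReal ContDiff

noncomputable section

/-- `g` is a weak derivative of `f : ℝ → ℂ` on the open set `I`: both are locally integrable on
`I`, and `∫_I φ' f = -∫_I φ g` for every smooth `φ` with compact support inside `I`. -/
structure HasWeakDeriv (I : Set ℝ) (f g : ℝ → ℂ) : Prop where
  locallyIntegrableOn : LocallyIntegrableOn f I
  locallyIntegrableOn_deriv : LocallyIntegrableOn g I
  integral_eq : ∀ φ : ℝ → ℝ, ContDiff ℝ ∞ φ → HasCompactSupport φ → tsupport φ ⊆ I →
    ∫ x in I, deriv φ x • f x = -∫ x in I, φ x • g x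

/-- A weak derivative on an open set is unique up to a null set. -/
theorem HasWeakDeriv.ae_unique {I : Set ℝ} (hI : IsOpen I) {f g h : ℝ → ℂ}
    (hg : HasWeakDeriv I f g) (hh : HasWeakDeriv I f h) : g =ᵐ[volume.restrict I] h := by
  have key : ∀ᵐ x ∂(volume : Measure ℝ), x ∈ I → (g - h) x = 0 := by
    refine hI.ae_eq_zero_of_integral_contDiff_smul_eq_zero
      (hg.locallyIntegrableOn_deriv.sub hh.locallyIntegrableOn_deriv) ?_
    intro φ hφ hc hs
    have hint : ∀ u : ℝ → ℂ, LocallyIntegrableOn u I → Integrable (fun x => φ x • u x) := by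
      intro u hu
      have h1 : IntegrableOn u (tsupport φ) := hu.integrableOn_compact_subset hs hc
      have h2 : IntegrableOn (fun x => φ x • u x) (tsupport φ) :=
        h1.continuousOn_smul hφ.continuous.continuousOn hc
      refine (integrableOn_iff_integrable_of_support_subset ?_).1 h2
      intro x hx
      refine subset_tsupport φ ?_
      intro h0
      exact hx (by simp [h0])
    have hset : ∀ u : ℝ → ℂ, ∫ x in I, φ x • u x = ∫ x, φ x • u x := by
      intro u
      refine setIntegral_eq_integral_of_forall_compl_eq_zero ?_
      intro x hx
      have : φ x = 0 := image_eq_zero_of_notMem_tsupport (fun h' => hx (hs h'))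
      simp [this]
    have e1 := hg.integral_eq φ hφ hc hs
    have e2 := hh.integral_eq φ hφ hc hs
    rw [hset] at e1 e2
    have e3 : ∫ x, φ x • g x = ∫ x, φ x • h x := neg_injective (e1.symm.trans e2)
    simp only [Pi.sub_apply, smul_sub]
    rw [integral_sub (hint g hg.locallyIntegrableOn_deriv)
      (hint h hh.locallyIntegrableOn_deriv), e3, sub_self]
  refine (ae_restrict_iff' hI.measurableSet).2 ?_
  filter_upwards [key] with x hx hxI
  exact sub_eq_zero.1 (hx hxI)

open Classical in
/-- The weak derivative of `f` on `I` (a chosen representative; the value is `0` if `f` has no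
weak derivative on `I`). -/
def weakDeriv (I : Set ℝ) (f : ℝ → ℂ) : ℝ → ℂ :=
  if h : ∃ g, HasWeakDeriv I f g then h.choose else 0

/-- The chosen weak derivative agrees almost everywhere with any weak derivative. -/
theorem HasWeakDeriv.weakDeriv_ae_eq {I : Set ℝ} (hI : IsOpen I) {f g : ℝ → ℂ}
    (hg : HasWeakDeriv I f g) : weakDeriv I f =ᵐ[volume.restrict I] g := by
  have h : ∃ g, HasWeakDeriv I f g := ⟨g, hg⟩
  rw [weakDeriv, dif_pos h]
  exact h.choose_spec.ae_unique hI hg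

/-- `f ∈ H¹(I)`: `f` lies in `L²(I)` and has a weak derivative in `L²(I)`. -/
def MemH1 (I : Set ℝ) (f : ℝ → ℂ) : Prop :=
  MemLp f 2 (volume.restrict I) ∧
    ∃ g, HasWeakDeriv I f g ∧ MemLp g 2 (volume.restrict I)

/-- `f = (f_k)` lies in `H¹_c(𝒢)`, where `𝒢` is the star graph made of `N` half-lines `[0, ∞)`
glued at `0`: every component is in `H¹(0, ∞)` and is given by its continuous representative on
`[0, ∞)`, and all the components have the same value at the vertex.
Values at negative arguments play no role. -/
structure MemH1c {N : ℕ} (f : Fin N → ℝ → ℂ) : Prop where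
  memH1 : ∀ k, MemH1 (Ioi 0) (f k)
  continuousOn : ∀ k, ContinuousOn (f k) (Ici 0)
  vertex : ∀ j k, f j 0 = f k 0

/-- The norm of `L^q(I)`. -/
def lineNorm (I : Set ℝ) (q : ℝ) (f : ℝ → ℂ) : ℝ≥0∞ :=
  eLpNorm f (ENNReal.ofReal q) (volume.restrict I)

/-- The norm of `L^q(𝒢)`, `1 ≤ q < ∞`: its `q`-th power is the sum of the `q`-th powers of the
`L^q(0, ∞)` norms of the components. -/
def graphNorm {N : ℕ} (q : ℝ) (f : Fin N → ℝ → ℂ) : ℝ≥0∞ :=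
  (∑ k, lineNorm (Ioi 0) q (f k) ^ q) ^ (1 / q)

/-- The componentwise weak derivative of a function on the star graph. -/
def graphDeriv {N : ℕ} (f : Fin N → ℝ → ℂ) : Fin N → ℝ → ℂ :=
  fun k => weakDeriv (Ioi 0) (f k)

/-- The `Ḣ¹_γ(𝒢)` norm `(‖∂ₓf‖²_{L²(𝒢)} + N γ |f₁(0)|²)^{1/2}`, for `γ ≥ 0`; the component `f₁` is
`f 0`. -/
def graphHdotNorm {N : ℕ} [NeZero N] (γ : ℝ) (f : Fin N → ℝ → ℂ) : ℝ≥0∞ :=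
  (graphNorm 2 (graphDeriv f) ^ (2 : ℝ) + N * ENNReal.ofReal γ * ‖f 0 0‖ₑ ^ (2 : ℝ)) ^ (1 / 2 : ℝ)

/-- The constants `C` for which the Gagliardo–Nirenberg inequality
`‖f‖_{p+1}^{p+1} ≤ C ‖f‖_2^{(p+3)/2} ‖f‖_{Ḣ¹_γ}^{(p-1)/2}` holds for all `f ∈ H¹_c(𝒢)`. -/
def graphGNConstants (N : ℕ) [NeZero N] (γ p : ℝ) : Set ℝ≥0 :=
  {C | ∀ f : Fin N → ℝ → ℂ, MemH1c f →
    graphNorm (p + 1) f ^ (p + 1) ≤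
      C * graphNorm 2 f ^ ((p + 3) / 2) * graphHdotNorm γ f ^ ((p - 1) / 2)}

/-- The constants `C` for which the Gagliardo–Nirenberg inequality
`‖g‖_{p+1}^{p+1} ≤ C ‖g‖_2^{(p+3)/2} ‖∂ₓg‖_2^{(p-1)/2}` holds for all `g ∈ H¹(ℝ)`. -/
def lineGNConstants (p : ℝ) : Set ℝ≥0 :=
  {C | ∀ g : ℝ → ℂ, MemH1 univ g →
    lineNorm univ (p + 1) g ^ (p + 1) ≤
      C * lineNorm univ 2 g ^ ((p + 3) / 2) * lineNorm univ 2 (weakDeriv univ g) ^ ((p - 1) / 2)}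

/-- The best constant `C_GN(γ)` on the star graph with `N` edges. -/
def graphGN (N : ℕ) [NeZero N] (γ p : ℝ) : ℝ≥0 := sInf (graphGNConstants N γ p)

/-- The best constant `C_GN^line` on the real line. -/
def lineGN (p : ℝ) : ℝ≥0 := sInf (lineGNConstants p)

end

/-! Both sets of admissible constants turn out to be the same ray, starting at the explicit number
`sharpGN p`.

Upper bound, by a Bogomolny (Modica–Mortola) argument. Put u = |f_k|, whose increments are
controlled by integrals of h = |f_k'|, and normalise sup u = 1. Completing the square gives t²h² +
u² − u^{p+1} ≥ 2t h √(u² − u^{p+1}), and the integral of the right side bounds the variation of 2t ·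
`solitonAction p` along u. From a near-maximum there are two disjoint routes to infinity: outwards
on its own edge, and back through the vertex onto another edge. Letting the height tend to 1, each
costs 2tK with K = `solitonAction p 1`, so t²D + A − P ≥ 4tK, where A, D, P are the integrals of u²,
h², u^{p+1} over the graph (`action_le_star_energy`). The best t and a weighted AM–GM inequality
yield P ≤ `sharpGN p` · A^{1+α} D^α with α = (p−1)/4 (`star_gagliardo_nirenberg`). Two edges
suffice, so the line folded at 0 is the case N = 2; on the graph the γ term only enlarges the right
side.

Lower bound. The soliton Q(x) = cosh((p−1)x/2)^{−2/(p−1)} gives equality on the line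
(`sharpGN_le_of_soliton_le`). On the star, centre it at distance L on one edge and put its tail on
every other edge. As L → ∞ the tails and the vertex term vanish, and the line quotient is recovered
in the limit (`sharpGN_le_of_mem_graphGNConstants`). -/

/-! ### Weak derivatives and primitives -/

/-- Integration by parts for absolutely continuous functions; the primitive has derivative g almost
everywhere by Lebesgue differentiation. -/
theorem integral_deriv_mul_primitive {a b c : ℝ} {φ g : ℝ → ℝ} (hφ : ContDiff ℝ ∞ φ)
    (hg : IntervalIntegrable g volume a b) (hc : c ∈ uIcc a b) (ha : φ a = 0) (hb : φ b = 0) :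
    ∫ x in a..b, deriv φ x * (∫ t in c..x, g t) = -∫ x in a..b, φ x * g x := by
  have h1 : AbsolutelyContinuousOnInterval φ a b :=
    (hφ.of_le (by exact_mod_cast le_top)).contDiffOn.absolutelyContinuousOnInterval
  have h2 := hg.absolutelyContinuousOnInterval_intervalIntegral hc
  have h3 := h1.integral_mul_deriv_eq_deriv_mul h2
  have h4 : ∫ x in a..b, φ x * deriv (fun y => ∫ t in c..y, g t) x = ∫ x in a..b, φ x * g x := by
    refine intervalIntegral.integral_congr_ae ?_
    filter_upwards [hg.ae_hasDerivAt_integral] with x hx hx'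
    rw [(hx (uIoc_subset_uIcc hx') c hc).deriv]
  rw [h4, ha, hb] at h3
  linarith

/-- Reduced to the real case by applying the real and imaginary part functionals. -/
theorem integral_deriv_smul_primitive {a b c : ℝ} {φ : ℝ → ℝ} {g : ℝ → ℂ} (hφ : ContDiff ℝ ∞ φ)
    (hg : IntervalIntegrable g volume a b) (hc : c ∈ uIcc a b) (ha : φ a = 0) (hb : φ b = 0) :
    ∫ x in a..b, deriv φ x • (∫ t in c..x, g t) = -∫ x in a..b, φ x • g x := by
  have hφ' : Continuous (deriv φ) := hφ.continuous_deriv (by exact_mod_cast le_top)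
  have i1 : IntervalIntegrable (fun x => deriv φ x • (∫ t in c..x, g t)) volume a b := by
    refine ContinuousOn.intervalIntegrable (hφ'.continuousOn.smul ?_)
    exact intervalIntegral.continuousOn_primitive_interval' hg hc
  have i2 : IntervalIntegrable (fun x => φ x • g x) volume a b :=
    hg.continuousOn_smul hφ.continuous.continuousOn
  have key : ∀ L : ℂ →L[ℝ] ℝ, L (∫ x in a..b, deriv φ x • (∫ t in c..x, g t)) =
      L (-∫ x in a..b, φ x • g x) := by
    intro L
    have hgL : IntervalIntegrable (fun x => L (g x)) volume a b :=
      ⟨L.integrable_comp hg.1, L.integrable_comp hg.2⟩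
    have := integral_deriv_mul_primitive hφ hgL hc ha hb
    rw [map_neg, ← L.intervalIntegral_comp_comm i1, ← L.intervalIntegral_comp_comm i2]
    simp only [map_smul, smul_eq_mul]
    rw [← this]
    refine intervalIntegral.integral_congr fun x hx => ?_
    rw [← L.intervalIntegral_comp_comm (hg.mono_set (uIcc_subset_uIcc hc hx))]
  exact Complex.ext (key Complex.reCLM) (key Complex.imCLM)

theorem exists_Ioo_of_isCompact_subset {I K : Set ℝ} (hI : IsOpen I) {x₀ : ℝ} (hx₀ : x₀ ∈ I)
    (hK : IsCompact K) (hKI : K ⊆ I) :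
    ∃ a ∈ I, ∃ b ∈ I, a < x₀ ∧ x₀ < b ∧ K ⊆ Ioo a b := by
  have hK' : IsCompact (insert x₀ K) := hK.insert x₀
  have hne : (insert x₀ K).Nonempty := ⟨x₀, mem_insert _ _⟩
  have hsub : insert x₀ K ⊆ I := insert_subset hx₀ hKI
  obtain ⟨m, hm, hm'⟩ := hK'.exists_isLeast hne
  obtain ⟨M, hM, hM'⟩ := hK'.exists_isGreatest hne
  obtain ⟨a, ha, haI⟩ := (mem_nhdsLT_iff_exists_Ioo_subset).1
    (mem_nhdsWithin_of_mem_nhds (hI.mem_nhds (hsub hm)))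
  obtain ⟨b, hb, hbI⟩ := (mem_nhdsGT_iff_exists_Ioo_subset).1
    (mem_nhdsWithin_of_mem_nhds (hI.mem_nhds (hsub hM)))
  obtain ⟨a', ha'⟩ := exists_between (show a < m from ha)
  obtain ⟨b', hb'⟩ := exists_between (show M < b from hb)
  refine ⟨a', haI ha', b', hbI hb', ha'.2.trans_le (hm' (mem_insert _ _)),
    (hM' (mem_insert _ _)).trans_lt hb'.1, fun x hx => ?_⟩
  exact ⟨ha'.2.trans_le (hm' (mem_insert_of_mem _ hx)),
    (hM' (mem_insert_of_mem _ hx)).trans_lt hb'.1⟩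

theorem setIntegral_eq_intervalIntegral_of_tsupport {I : Set ℝ} (hI : I.OrdConnected)
    {a b : ℝ} (ha : a ∈ I) (hb : b ∈ I) (hab : a ≤ b) {F : ℝ → ℂ}
    (hF : ∀ x ∉ Ioo a b, F x = 0) : ∫ x in I, F x = ∫ x in a..b, F x := by
  have hsub : Ioc a b ⊆ I := Ioc_subset_Icc_self.trans (hI.out ha hb)
  rw [intervalIntegral.integral_of_le hab,
    setIntegral_eq_integral_of_forall_compl_eq_zero, setIntegral_eq_integral_of_forall_compl_eq_zero]
  · exact fun x hx => hF x fun h => hx (Ioo_subset_Ioc_self h)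
  · exact fun x hx => hF x fun h => hx (hsub (Ioo_subset_Ioc_self h))

theorem continuousOn_primitive_of_locallyIntegrableOn {I : Set ℝ} (hI : IsOpen I)
    (hIc : I.OrdConnected) {x₀ : ℝ} (hx₀ : x₀ ∈ I) {g : ℝ → ℂ} (hg : LocallyIntegrableOn g I) :
    ContinuousOn (fun x => ∫ t in x₀..x, g t) I := by
  intro x hx
  obtain ⟨a, ha, b, hb, h1, h2, h3⟩ := exists_Ioo_of_isCompact_subset hI hx₀
    (isCompact_singleton (x := x)) (by simpa using hx)
  have hii : IntervalIntegrable g volume a b := by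
    refine (hg.integrableOn_compact_subset ?_ isCompact_uIcc).intervalIntegrable
    exact hIc.uIcc_subset ha hb
  have := intervalIntegral.continuousOn_primitive_interval' hii
    (by rw [uIcc_of_le (h1.trans h2).le]; exact ⟨h1.le, h2.le⟩ : x₀ ∈ uIcc a b)
  refine (this.continuousAt ?_).continuousWithinAt
  rw [uIcc_of_le (h1.trans h2).le]
  exact Icc_mem_nhds (h3 rfl).1 (h3 rfl).2

/-- The du Bois-Reymond lemma: f minus the primitive of g has zero weak derivative, hence is almost
everywhere constant. -/
theorem HasWeakDeriv.exists_ae_eq_primitive {I : Set ℝ} (hI : IsOpen I) (hIc : I.OrdConnected)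
    {x₀ : ℝ} (hx₀ : x₀ ∈ I) {f g : ℝ → ℂ} (h : HasWeakDeriv I f g) :
    ∃ c : ℂ, ∀ᵐ x, x ∈ I → f x = c + ∫ t in x₀..x, g t := by
  set F : ℝ → ℂ := fun x => ∫ t in x₀..x, g t with hF
  have hFc : ContinuousOn F I :=
    continuousOn_primitive_of_locallyIntegrableOn hI hIc hx₀ h.locallyIntegrableOn_deriv
  have hFl : LocallyIntegrableOn F I := hFc.locallyIntegrableOn hI.measurableSet
  have hk : LocallyIntegrableOn (fun x => f x - F x) I := h.locallyIntegrableOn.sub hFl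
  have hint : ∀ (u : ℝ → ℂ), LocallyIntegrableOn u I → ∀ φ : ℝ → ℝ, Continuous φ →
      HasCompactSupport φ → tsupport φ ⊆ I → IntegrableOn (fun x => φ x • u x) I := by
    intro u hu φ hφ hc hs
    have h1 : IntegrableOn u (tsupport φ) := hu.integrableOn_compact_subset hs hc
    have h2 : IntegrableOn (fun x => φ x • u x) (tsupport φ) :=
      h1.continuousOn_smul hφ.continuousOn hc
    refine ((integrableOn_iff_integrable_of_support_subset ?_).1 h2).integrableOn
    intro x hx
    exact subset_tsupport φ fun h0 => hx (by simp [h0])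
  -- the difference of `f` and the primitive is orthogonal to derivatives of test functions
  have orth : ∀ φ : ℝ → ℝ, ContDiff ℝ ∞ φ → HasCompactSupport φ → tsupport φ ⊆ I →
      ∫ x in I, deriv φ x • (f x - F x) = 0 := by
    intro φ hφ hc hs
    have hφ' : Continuous (deriv φ) := hφ.continuous_deriv (by exact_mod_cast le_top)
    have hs' : tsupport (deriv φ) ⊆ I := (tsupport_deriv_subset (𝕜 := ℝ)).trans hs
    obtain ⟨a, ha, b, hb, h1, h2, h3⟩ := exists_Ioo_of_isCompact_subset hI hx₀ hc hs
    have hab := (h1.trans h2).le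
    have hz : ∀ x ∉ Ioo a b, φ x = 0 := fun x hx =>
      image_eq_zero_of_notMem_tsupport fun h' => hx (h3 h')
    have hz' : ∀ x ∉ Ioo a b, deriv φ x = 0 := fun x hx =>
      image_eq_zero_of_notMem_tsupport fun h' => hx (h3 (tsupport_deriv_subset (𝕜 := ℝ) h'))
    have hii : IntervalIntegrable g volume a b :=
      (h.locallyIntegrableOn_deriv.integrableOn_compact_subset (hIc.uIcc_subset ha hb)
        isCompact_uIcc).intervalIntegrable
    have e := integral_deriv_smul_primitive hφ hii
      (by rw [uIcc_of_le hab]; exact ⟨h1.le, h2.le⟩ : x₀ ∈ uIcc a b)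
      (hz a (by simp)) (hz b (by simp))
    rw [← setIntegral_eq_intervalIntegral_of_tsupport hIc ha hb hab
        (fun x hx => by rw [hz' x hx, zero_smul]),
      ← setIntegral_eq_intervalIntegral_of_tsupport hIc ha hb hab
        (fun x hx => by rw [hz x hx, zero_smul])] at e
    simp only [smul_sub]
    rw [integral_sub (hint f h.locallyIntegrableOn _ hφ' hc.deriv hs')
      (hint F hFl _ hφ' hc.deriv hs'), h.integral_eq φ hφ hc hs, e, sub_self]
  -- a test function of integral one
  obtain ⟨r, hr, hrI⟩ := Metric.isOpen_iff.1 hI x₀ hx₀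
  let B : ContDiffBump x₀ := ⟨r / 4, r / 2, by positivity, by linarith⟩
  set ψ : ℝ → ℝ := B.normed volume with hψ
  have ψs : tsupport ψ ⊆ I := by
    rw [hψ, B.tsupport_normed_eq]
    exact (Metric.closedBall_subset_ball (by simp [B]; linarith)).trans hrI
  have ψd : ContDiff ℝ ∞ ψ := B.contDiff_normed
  have ψc : HasCompactSupport ψ := B.hasCompactSupport_normed
  have ψ1 : ∫ x, ψ x = 1 := B.integral_normed
  refine ⟨∫ x in I, ψ x • (f x - F x), ?_⟩
  set c : ℂ := ∫ x in I, ψ x • (f x - F x) with hcdef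
  have main : ∀ᵐ x, x ∈ I → f x - F x - c = 0 := by
    refine hI.ae_eq_zero_of_integral_contDiff_smul_eq_zero
      (hk.sub (locallyIntegrableOn_const c)) ?_
    intro η ηd ηc ηs
    set m : ℝ := ∫ x, η x with hm
    -- Subtracting m ψ makes the mean zero, so the primitive of ζ is compactly supported and ζ is
    -- the derivative of a test function, to which `orth` applies.
    set ζ : ℝ → ℝ := fun x => η x - m * ψ x with hζ
    have ζcont : Continuous ζ := ηd.continuous.sub (continuous_const.mul ψd.continuous)
    have ζs : ∀ x, x ∉ tsupport η ∪ tsupport ψ → ζ x = 0 := by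
      intro x hx
      rw [mem_union, not_or] at hx
      simp [hζ, image_eq_zero_of_notMem_tsupport hx.1, image_eq_zero_of_notMem_tsupport hx.2]
    have ηi : Integrable η := ηd.continuous.integrable_of_hasCompactSupport ηc
    have ψi : Integrable ψ := ψd.continuous.integrable_of_hasCompactSupport ψc
    have ζ0 : ∫ x, ζ x = 0 := by
      rw [hζ, integral_sub ηi (ψi.const_mul m), integral_const_mul, ψ1, ← hm, mul_one, sub_self]
    obtain ⟨a, ha, b, hb, h1, h2, h3⟩ := exists_Ioo_of_isCompact_subset hI hx₀
      (ηc.isCompact.union ψc.isCompact) (union_subset ηs ψs)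
    have hab := (h1.trans h2).le
    have ζz : ∀ x ∉ Ioo a b, ζ x = 0 := fun x hx => ζs x fun h' => hx (h3 h')
    set φ : ℝ → ℝ := fun x => ∫ t in a..x, ζ t with hφ
    have φd : ∀ x, HasDerivAt φ (ζ x) x := fun x =>
      intervalIntegral.integral_hasDerivAt_right (ζcont.intervalIntegrable _ _)
        (ζcont.stronglyMeasurableAtFilter _ _) ζcont.continuousAt
    have φd' : deriv φ = ζ := funext fun x => (φd x).deriv
    have ζd : ContDiff ℝ ∞ ζ := ηd.sub (contDiff_const.mul ψd)
    have φsm : ContDiff ℝ ∞ φ := by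
      rw [contDiff_infty_iff_deriv, φd']
      exact ⟨fun x => (φd x).differentiableAt, ζd⟩
    have φb : φ b = 0 := by
      rw [hφ]
      dsimp only
      rw [intervalIntegral.integral_of_le hab,
        setIntegral_eq_integral_of_forall_compl_eq_zero, ζ0]
      exact fun x hx => ζz x fun h => hx (Ioo_subset_Ioc_self h)
    obtain ⟨a', ha'K, ha'⟩ : ∃ a', a < a' ∧ ∀ x, x < a' → ζ x = 0 := by
      obtain ⟨q, hq⟩ := ((ηc.isCompact.union ψc.isCompact).insert x₀).exists_isLeast
        ⟨x₀, mem_insert _ _⟩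
      refine ⟨q, ?_, fun x hx => ζs x fun h' => (hq.2 (mem_insert_of_mem _ h')).not_gt hx⟩
      rcases hq.1 with h' | h'
      · rw [h']; exact h1
      · exact (h3 h').1
    obtain ⟨b', hb'K, hb'⟩ : ∃ b', b' < b ∧ ∀ x, b' < x → ζ x = 0 := by
      obtain ⟨q, hq⟩ := ((ηc.isCompact.union ψc.isCompact).insert x₀).exists_isGreatest
        ⟨x₀, mem_insert _ _⟩
      refine ⟨q, ?_, fun x hx => ζs x fun h' => (hq.2 (mem_insert_of_mem _ h')).not_gt hx⟩
      rcases hq.1 with h' | h'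
      · rw [h']; exact h2
      · exact (h3 h').2
    have φs : Function.support φ ⊆ Icc a' b' := by
      intro x hx
      by_contra hx'
      apply hx
      rw [mem_Icc, not_and_or, not_le, not_le] at hx'
      rcases hx' with hx' | hx'
      · refine intervalIntegral.integral_zero_ae (Filter.Eventually.of_forall fun t ht => ?_)
        refine ha' t (lt_of_le_of_lt ht.2 (max_lt ha'K hx'))
      · rw [← φb, hφ, ← sub_eq_zero, intervalIntegral.integral_interval_sub_left
          (ζcont.intervalIntegrable _ _) (ζcont.intervalIntegrable _ _)]
        refine intervalIntegral.integral_zero_ae (Filter.Eventually.of_forall fun t ht => ?_)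
        exact hb' t (lt_of_le_of_lt (le_min hb'K.le hx'.le) ht.1)
    have φts : tsupport φ ⊆ Icc a' b' := closure_minimal φs isClosed_Icc
    have φc : HasCompactSupport φ := isCompact_Icc.of_isClosed_subset isClosed_closure φts
    have φI : tsupport φ ⊆ I :=
      (φts.trans (Icc_subset_Icc ha'K.le hb'K.le)).trans (hIc.out ha hb)
    have o := orth φ φsm φc φI
    rw [φd'] at o
    have iη := hint _ hk η ηd.continuous ηc ηs
    have iψ := hint _ hk ψ ψd.continuous ψc ψs
    have o' : ∫ x in I, η x • (f x - F x) = m • c := by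
      have : ∀ x, ζ x • (f x - F x) = η x • (f x - F x) - m • (ψ x • (f x - F x)) := by
        intro x
        rw [hζ, sub_smul, mul_smul]
      simp only [this] at o
      rw [integral_sub iη (by exact iψ.smul m), integral_smul] at o
      exact sub_eq_zero.1 o
    have e1 : ∫ x, η x • (f x - F x - c) = ∫ x in I, η x • (f x - F x - c) := by
      refine (setIntegral_eq_integral_of_forall_compl_eq_zero fun x hx => ?_).symm
      rw [image_eq_zero_of_notMem_tsupport fun h' => hx (ηs h'), zero_smul]
    have e2 : ∫ x in I, η x = m := by
      refine setIntegral_eq_integral_of_forall_compl_eq_zero fun x hx => ?_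
      rw [image_eq_zero_of_notMem_tsupport fun h' => hx (ηs h')]
    rw [e1]
    simp only [smul_sub (M := ℝ) _ (_ - _) c]
    rw [integral_sub iη (ηi.integrableOn.smul_const c), o', integral_smul_const, e2, sub_self]
  filter_upwards [main] with x hx hxI
  have := hx hxI
  rw [sub_sub, sub_eq_zero, add_comm] at this
  exact this

/-! ### A chain rule inequality without derivatives of u -/

open Filter Topology in
/-- A chain rule inequality: if the increments of `u` are bounded by the integrals of `h`, then the
increments of `H ∘ u` are bounded by those of `(H' ∘ u) h`. -/
theorem abs_comp_sub_le_integral {a b : ℝ} (hab : a ≤ b) {u h G H : ℝ → ℝ}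
    (hu : ContinuousOn u (Icc a b)) (hh : IntervalIntegrable h volume a b) (h0 : ∀ x, 0 ≤ h x)
    (hle : ∀ x ∈ Icc a b, ∀ y ∈ Icc a b, x ≤ y → |u y - u x| ≤ ∫ t in x..y, h t)
    (hG : Continuous G) (G0 : ∀ s, 0 ≤ G s) (hH : ∀ s, HasDerivAt H (G s) s) :
    |H (u b) - H (u a)| ≤ ∫ x in a..b, G (u x) * h x := by
  have hGu : ContinuousOn (fun x => G (u x)) (Icc a b) := hG.comp_continuousOn hu
  have hint : ∀ x ∈ Icc a b, ∀ y ∈ Icc a b, IntervalIntegrable h volume x y := fun x hx y hy =>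
    hh.mono_set (by rw [uIcc_of_le hab]; exact ordConnected_Icc.uIcc_subset hx hy)
  have hintG : ∀ c : ℝ, ∀ x ∈ Icc a b, ∀ y ∈ Icc a b,
      IntervalIntegrable (fun t => (G (u t) + c) * h t) volume x y := fun c x hx y hy =>
    (hint x hx y hy).continuousOn_mul
      ((hGu.add continuousOn_const).mono (ordConnected_Icc.uIcc_subset hx hy))
  have ham : a ∈ Icc a b := left_mem_Icc.2 hab
  have hbm : b ∈ Icc a b := right_mem_Icc.2 hab
  -- The slack ε absorbs the oscillation of G ∘ u on short intervals: half of it when G is frozen at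
  -- u x, half when it is released.
  have key : ∀ ε > 0, |H (u b) - H (u a)| ≤ ∫ x in a..b, (G (u x) + ε) * h x := by
    intro ε hε
    have hHc : Continuous H := continuous_iff_continuousAt.2 fun s => (hH s).continuousAt
    set s : Set ℝ := {x | |H (u x) - H (u a)| ≤ ∫ t in a..x, (G (u t) + ε) * h t} with hs
    have hclosed : IsClosed (s ∩ Icc a b) := by
      have c1 : ContinuousOn (fun x => |H (u x) - H (u a)|) (Icc a b) :=
        ((hHc.comp_continuousOn hu).sub continuousOn_const).abs
      have c2 : ContinuousOn (fun x => ∫ t in a..x, (G (u t) + ε) * h t) (Icc a b) := by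
        have := intervalIntegral.continuousOn_primitive_interval' (hintG ε a ham b hbm)
          (left_mem_uIcc (a := a) (b := b))
        rwa [uIcc_of_le hab] at this
      have := isClosed_Icc.isClosed_le c1 c2
      convert this using 1
      ext x
      simp [hs, and_comm]
    have hsub : Icc a b ⊆ s := by
      -- Continuous induction: the set of good endpoints is closed and can always be extended a
      -- little to the right.
      refine hclosed.Icc_subset_of_forall_mem_nhdsWithin (by simp [hs]) ?_
      rintro x ⟨hxs, hx⟩
      have hxm : x ∈ Icc a b := Ico_subset_Icc_self hx
      obtain ⟨η, hη, hGη⟩ := Metric.continuousAt_iff.1 (hG.continuousAt (x := u x)) (ε / 2)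
        (by positivity)
      obtain ⟨δ, hδ, huδ⟩ := Metric.continuousWithinAt_iff.1 (hu x hxm) η hη
      have : Ioo x (min (x + δ) b) ∈ 𝓝[>] x :=
        Ioo_mem_nhdsGT (lt_min (by linarith) hx.2)
      filter_upwards [this] with y hy
      have hyb : y < b := hy.2.trans_le (min_le_right _ _)
      have hyδ : y < x + δ := hy.2.trans_le (min_le_left _ _)
      have hym : y ∈ Icc a b := ⟨hx.1.trans hy.1.le, hyb.le⟩
      have hclose : ∀ t ∈ Icc x y, u t ∈ Metric.ball (u x) η := by
        intro t ht
        refine huδ ⟨hx.1.trans ht.1, ht.2.trans hyb.le⟩ ?_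
        rw [Real.dist_eq, abs_of_nonneg (by linarith [ht.1])]
        linarith [ht.2]
      have hGt : ∀ r ∈ Metric.ball (u x) η, |G r - G (u x)| < ε / 2 := fun r hr => hGη hr
      have m1 : |H (u y) - H (u x)| ≤ (G (u x) + ε / 2) * |u y - u x| := by
        have := (convex_ball (u x) η).norm_image_sub_le_of_norm_hasDerivWithin_le
          (f := H) (f' := G) (C := G (u x) + ε / 2) (fun r _ => (hH r).hasDerivWithinAt)
          (fun r hr => by
            rw [Real.norm_eq_abs, abs_of_nonneg (G0 r)]
            linarith [(abs_lt.1 (hGt r hr)).2])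
          (Metric.mem_ball_self hη) (hclose y (right_mem_Icc.2 hy.1.le))
        simpa [Real.norm_eq_abs] using this
      have m2 : (G (u x) + ε / 2) * |u y - u x| ≤ ∫ t in x..y, (G (u t) + ε) * h t := by
        refine (mul_le_mul_of_nonneg_left (hle x hxm y hym hy.1.le)
          (by linarith [G0 (u x)])).trans ?_
        rw [← intervalIntegral.integral_const_mul]
        refine intervalIntegral.integral_mono_on hy.1.le ((hint x hxm y hym).const_mul _)
          (hintG ε x hxm y hym) fun t ht => ?_
        refine mul_le_mul_of_nonneg_right ?_ (h0 t)
        linarith [(abs_lt.1 (hGt _ (hclose t ht))).1]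
      have m3 := intervalIntegral.integral_add_adjacent_intervals (hintG ε a ham x hxm)
        (hintG ε x hxm y hym)
      have m4 := abs_sub_le (H (u y)) (H (u x)) (H (u a))
      have m5 : |H (u x) - H (u a)| ≤ ∫ t in a..x, (G (u t) + ε) * h t := hxs
      change |H (u y) - H (u a)| ≤ ∫ t in a..y, (G (u t) + ε) * h t
      linarith
    exact hsub hbm
  have hlim : Tendsto (fun ε : ℝ => (∫ x in a..b, G (u x) * h x) + ε * ∫ x in a..b, h x) (𝓝[>] 0)
      (𝓝 (∫ x in a..b, G (u x) * h x)) := by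
    have : Continuous (fun ε : ℝ => (∫ x in a..b, G (u x) * h x) + ε * ∫ x in a..b, h x) := by
      fun_prop
    simpa using (this.tendsto 0).mono_left nhdsWithin_le_nhds
  refine ge_of_tendsto hlim ?_
  filter_upwards [self_mem_nhdsWithin] with ε hε
  refine (key ε hε).trans_eq ?_
  rw [← intervalIntegral.integral_const_mul, ← intervalIntegral.integral_add]
  · simp only [add_mul]
  · simpa using hintG 0 a ham b hbm
  · exact hh.const_mul ε

/-! ### Controlled functions on the half-line -/

/-- A nonnegative function `u` on the half-line `[0, ∞)`, square integrable together with a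
nonnegative function `h` which controls the increments of `u`. -/
structure ControlledOnHalfLine (u h : ℝ → ℝ) : Prop where
  continuousOn : ContinuousOn u (Ici 0)
  nonneg : ∀ x, 0 ≤ u x
  bound_nonneg : ∀ x, 0 ≤ h x
  bound_measurable : AEStronglyMeasurable h (volume.restrict (Ioi 0))
  integrable_sq : IntegrableOn (fun x => u x ^ 2) (Ioi 0)
  integrable_bound_sq : IntegrableOn (fun x => h x ^ 2) (Ioi 0)
  abs_sub_le : ∀ x y, 0 ≤ x → x ≤ y → |u y - u x| ≤ ∫ t in x..y, h t

namespace ControlledOnHalfLine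

variable {u h : ℝ → ℝ}

theorem const_mul (H : ControlledOnHalfLine u h) {c : ℝ} (hc : 0 ≤ c) :
    ControlledOnHalfLine (fun x => c * u x) (fun x => c * h x) where
  continuousOn := continuousOn_const.mul H.continuousOn
  nonneg x := mul_nonneg hc (H.nonneg x)
  bound_nonneg x := mul_nonneg hc (H.bound_nonneg x)
  bound_measurable := H.bound_measurable.const_mul c
  integrable_sq := by simp only [mul_pow]; exact H.integrable_sq.const_mul _
  integrable_bound_sq := by simp only [mul_pow]; exact H.integrable_bound_sq.const_mul _
  abs_sub_le x y hx hxy := by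
    rw [← mul_sub, abs_mul, abs_of_nonneg hc, intervalIntegral.integral_const_mul]
    exact mul_le_mul_of_nonneg_left (H.abs_sub_le x y hx hxy) hc

theorem intervalIntegrable (H : ControlledOnHalfLine u h) {x y : ℝ} (hx : 0 ≤ x) (hxy : x ≤ y) :
    IntervalIntegrable h volume x y := by
  have hsub : Ioc x y ⊆ Ioi 0 := fun t ht => hx.trans_lt ht.1
  rw [intervalIntegrable_iff_integrableOn_Ioc_of_le hxy]
  have i1 : IntegrableOn (fun t => 1 + h t ^ 2) (Ioc x y) :=
    (integrableOn_const measure_Ioc_lt_top.ne).add (H.integrable_bound_sq.mono_set hsub)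
  refine i1.mono' (H.bound_measurable.mono_set hsub) (Filter.Eventually.of_forall fun t => ?_)
  rw [Real.norm_eq_abs, abs_of_nonneg (H.bound_nonneg t)]
  nlinarith [sq_nonneg (h t - 1), H.bound_nonneg t]

/-- Otherwise u² would exceed its mean budget on a whole window of length L; the 1 makes the
contradiction strict. Short windows give boundedness, long ones give small values far out. -/
theorem exists_mul_sq_le (H : ControlledOnHalfLine u h) {x L : ℝ} (hx : 0 ≤ x) (hL : 0 < L) :
    ∃ y, x ≤ y ∧ y ≤ x + L ∧ L * u y ^ 2 ≤ (∫ t in Ioi 0, u t ^ 2) + 1 := by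
  by_contra! hcon
  have hsub : Ioc x (x + L) ⊆ Ioi 0 := fun t ht => hx.trans_lt ht.1
  have h1 : ∫ t in Ioc x (x + L), u t ^ 2 ≤ ∫ t in Ioi 0, u t ^ 2 :=
    setIntegral_mono_set H.integrable_sq
      (Filter.Eventually.of_forall fun t => sq_nonneg _) hsub.eventuallyLE
  have h2 : ∫ _ in Ioc x (x + L), ((∫ t in Ioi 0, u t ^ 2) + 1) / L ≤
      ∫ t in Ioc x (x + L), u t ^ 2 := by
    refine setIntegral_mono_on (integrableOn_const measure_Ioc_lt_top.ne)
      (H.integrable_sq.mono_set hsub) measurableSet_Ioc fun t ht => ?_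
    rw [div_le_iff₀ hL, mul_comm]
    exact (hcon t ht.1.le ht.2).le
  rw [setIntegral_const] at h2
  simp only [measureReal_def, Real.volume_Ioc, add_sub_cancel_left, ENNReal.toReal_ofReal hL.le,
    smul_eq_mul] at h2
  rw [mul_div_cancel₀ _ hL.ne'] at h2
  linarith

theorem exists_le (H : ControlledOnHalfLine u h) : ∃ B, ∀ x, 0 ≤ x → u x ≤ B := by
  set A := ∫ t in Ioi 0, u t ^ 2
  set D := ∫ t in Ioi 0, h t ^ 2
  -- Some y within distance 1 has u(y)² ≤ A + 1, so u(y) ≤ A + 2; and the increment from y to x is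
  -- at most ∫ h ≤ ∫ (1 + h²) ≤ 1 + D.
  refine ⟨(A + 2) + (1 + D), fun x hx => ?_⟩
  obtain ⟨y, hxy, hy, hu⟩ := H.exists_mul_sq_le hx one_pos
  have hsub : Ioc x y ⊆ Ioi 0 := fun t ht => hx.trans_lt ht.1
  have h1 := H.abs_sub_le x y hx hxy
  have h2 : ∫ t in x..y, h t ≤ ∫ t in x..y, (1 + h t ^ 2) := by
    refine intervalIntegral.integral_mono_on hxy (H.intervalIntegrable hx hxy)
      (intervalIntegrable_const.add ?_) fun t _ => ?_
    · exact (intervalIntegrable_iff_integrableOn_Ioc_of_le hxy).2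
        (H.integrable_bound_sq.mono_set hsub)
    · nlinarith [sq_nonneg (h t - 1), H.bound_nonneg t]
  rw [intervalIntegral.integral_add intervalIntegrable_const
    ((intervalIntegrable_iff_integrableOn_Ioc_of_le hxy).2
        (H.integrable_bound_sq.mono_set hsub)), intervalIntegral.integral_const,
      smul_eq_mul, mul_one, intervalIntegral.integral_of_le (f := fun t => h t ^ 2) hxy] at h2
  have h3 : ∫ t in Ioc x y, h t ^ 2 ≤ D :=
    setIntegral_mono_set H.integrable_bound_sq
      (Filter.Eventually.of_forall fun t => sq_nonneg _) hsub.eventuallyLE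
  have h4 : u x - u y ≤ |u y - u x| := by rw [abs_sub_comm]; exact le_abs_self _
  nlinarith [sq_nonneg (u y - 1)]

theorem integrable_rpow (H : ControlledOnHalfLine u h) {q : ℝ} (hq : 2 ≤ q) :
    IntegrableOn (fun x => u x ^ q) (Ioi 0) := by
  obtain ⟨B, hB⟩ := H.exists_le
  have hm : AEStronglyMeasurable (fun x => u x ^ q) (volume.restrict (Ioi 0)) :=
    ((H.continuousOn.rpow_const fun x _ => Or.inr (by linarith)).mono
      Ioi_subset_Ici_self).aestronglyMeasurable measurableSet_Ioi
  refine (H.integrable_sq.const_mul (B ^ (q - 2))).mono' hm ?_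
  refine (ae_restrict_iff' measurableSet_Ioi).2 (Filter.Eventually.of_forall fun x hx => ?_)
  have hx0 : 0 ≤ x := (show (0 : ℝ) < x from hx).le
  rw [Real.norm_eq_abs, abs_of_nonneg (Real.rpow_nonneg (H.nonneg x) _)]
  have : u x ^ q = u x ^ (q - 2) * u x ^ 2 := by
    rw [← Real.rpow_natCast (u x) 2, ← Real.rpow_add' (H.nonneg x) (by norm_num; linarith)]
    norm_num
  rw [this]
  exact mul_le_mul_of_nonneg_right
    (Real.rpow_le_rpow (H.nonneg x) (hB x hx0) (by linarith)) (sq_nonneg _)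

end ControlledOnHalfLine

/-! ### The soliton action -/

/-- The momentum `√(s² - s^{p+1})` of the soliton of height one at the level `s`. -/
noncomputable def solitonMomentum (p s : ℝ) : ℝ := √(s ^ 2 - s ^ (p + 1))

/-- The primitive of `solitonMomentum p` which vanishes at `0`. -/
noncomputable def solitonAction (p s : ℝ) : ℝ := ∫ r in 0..s, solitonMomentum p r

section soliton

variable {p : ℝ}

theorem continuous_solitonMomentum (hp : 1 < p) : Continuous (solitonMomentum p) := by
  have : Continuous fun s : ℝ => s ^ (p + 1) := Real.continuous_rpow_const (by linarith)
  unfold solitonMomentum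
  fun_prop

theorem solitonMomentum_nonneg (s : ℝ) : 0 ≤ solitonMomentum p s := Real.sqrt_nonneg _

/-- Above level 1 the radicand is negative and `√` returns 0, so the identity fails there; hence the
normalisation of the supremum to 1 later. -/
theorem solitonMomentum_sq (hp : 1 < p) {s : ℝ} (h0 : 0 ≤ s) (h1 : s ≤ 1) :
    solitonMomentum p s ^ 2 = s ^ 2 - s ^ (p + 1) := by
  refine Real.sq_sqrt (sub_nonneg.2 ?_)
  rw [← Real.rpow_natCast s 2]
  exact Real.rpow_le_rpow_of_exponent_ge_of_imp h0 h1 (by norm_num; linarith) (by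
    intro _ h; linarith)

theorem hasDerivAt_solitonAction (hp : 1 < p) (s : ℝ) :
    HasDerivAt (solitonAction p) (solitonMomentum p s) s :=
  intervalIntegral.integral_hasDerivAt_right
    ((continuous_solitonMomentum hp).intervalIntegrable _ _)
    ((continuous_solitonMomentum hp).stronglyMeasurableAtFilter _ _)
    (continuous_solitonMomentum hp).continuousAt

theorem continuous_solitonAction (hp : 1 < p) : Continuous (solitonAction p) :=
  continuous_iff_continuousAt.2 fun s => (hasDerivAt_solitonAction hp s).continuousAt

@[simp] theorem solitonAction_zero : solitonAction p 0 = 0 := by simp [solitonAction]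

theorem monotone_solitonAction (hp : 1 < p) : Monotone (solitonAction p) :=
  monotone_of_hasDerivAt_nonneg (hasDerivAt_solitonAction hp) fun s => solitonMomentum_nonneg s

theorem solitonAction_one_pos (hp : 1 < p) : 0 < solitonAction p 1 := by
  refine intervalIntegral.intervalIntegral_pos_of_pos_on
    ((continuous_solitonMomentum hp).intervalIntegrable _ _) (fun s hs => ?_) one_pos
  refine Real.sqrt_pos.2 (sub_pos.2 ?_)
  rw [← Real.rpow_natCast s 2]
  exact Real.rpow_lt_rpow_of_exponent_gt hs.1 hs.2 (by norm_num; linarith)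

end soliton

/-! ### Energy bounds from the action -/

namespace ControlledOnHalfLine

variable {u h : ℝ → ℝ} {p t : ℝ}

theorem integrable_energy (H : ControlledOnHalfLine u h) (hp : 1 < p) (t : ℝ) :
    IntegrableOn (fun x => t ^ 2 * h x ^ 2 + (u x ^ 2 - u x ^ (p + 1))) (Ioi 0) :=
  (H.integrable_bound_sq.const_mul _).add
    (H.integrable_sq.sub (H.integrable_rpow (by linarith)))

/-- Completing the square in t h − √(u² − u^{p+1}). -/
theorem momentum_mul_le_energy (H : ControlledOnHalfLine u h) (hp : 1 < p) (t : ℝ) {x : ℝ}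
    (hu : u x ≤ 1) :
    2 * t * (solitonMomentum p (u x) * h x) ≤ t ^ 2 * h x ^ 2 + (u x ^ 2 - u x ^ (p + 1)) := by
  rw [← solitonMomentum_sq hp (H.nonneg x) hu]
  nlinarith [sq_nonneg (t * h x - solitonMomentum p (u x))]

theorem energy_nonneg (H : ControlledOnHalfLine u h) (hp : 1 < p) (t : ℝ) {x : ℝ}
    (hu : u x ≤ 1) : 0 ≤ t ^ 2 * h x ^ 2 + (u x ^ 2 - u x ^ (p + 1)) := by
  rw [← solitonMomentum_sq hp (H.nonneg x) hu]
  positivity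

theorem action_sub_le_energy (H : ControlledOnHalfLine u h) (hp : 1 < p) (ht : 0 ≤ t)
    (hu : ∀ x, 0 ≤ x → u x ≤ 1) {a b : ℝ} (ha : 0 ≤ a) (hab : a ≤ b) :
    2 * t * |solitonAction p (u b) - solitonAction p (u a)| ≤
      ∫ x in Ioc a b, (t ^ 2 * h x ^ 2 + (u x ^ 2 - u x ^ (p + 1))) := by
  have hsub : Ioc a b ⊆ Ioi 0 := fun t ht => ha.trans_lt ht.1
  have hIcc : Icc a b ⊆ Ici 0 := fun t ht => ha.trans ht.1
  have hh := H.intervalIntegrable ha hab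
  have hu' : ContinuousOn u (Icc a b) := H.continuousOn.mono hIcc
  have h1 := abs_comp_sub_le_integral hab hu' hh H.bound_nonneg
    (fun x hx y _ hxy => H.abs_sub_le x y (hIcc hx) hxy) (continuous_solitonMomentum hp)
    (solitonMomentum_nonneg (p := p)) (hasDerivAt_solitonAction hp)
  refine (mul_le_mul_of_nonneg_left h1 (by linarith)).trans ?_
  rw [← intervalIntegral.integral_const_mul, ← intervalIntegral.integral_of_le hab]
  refine intervalIntegral.integral_mono_on hab (IntervalIntegrable.const_mul ?_ _)
    ((intervalIntegrable_iff_integrableOn_Ioc_of_le hab).2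
      ((H.integrable_energy hp t).mono_set hsub))
    fun x hx => H.momentum_mul_le_energy hp t (hu x (hIcc hx))
  refine hh.continuousOn_mul ?_
  rw [uIcc_of_le hab]
  exact (continuous_solitonMomentum hp).comp_continuousOn hu'

/-- Square integrability forces u below any ε at some b ≥ a, so almost all of the action at u a must
be paid between a and b; then ε → 0. -/
theorem action_le_energy (H : ControlledOnHalfLine u h) (hp : 1 < p) (ht : 0 ≤ t)
    (hu : ∀ x, 0 ≤ x → u x ≤ 1) {a : ℝ} (ha : 0 ≤ a) :
    2 * t * solitonAction p (u a) ≤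
      ∫ x in Ioi a, (t ^ 2 * h x ^ 2 + (u x ^ 2 - u x ^ (p + 1))) := by
  have hsub : Ioi a ⊆ Ioi 0 := Ioi_subset_Ioi ha
  have key : ∀ ε > 0, 2 * t * (solitonAction p (u a) - solitonAction p ε) ≤
      ∫ x in Ioi a, (t ^ 2 * h x ^ 2 + (u x ^ 2 - u x ^ (p + 1))) := by
    intro ε hε
    set A := ∫ t in Ioi 0, u t ^ 2 with hA
    have hA0 : 0 ≤ A := setIntegral_nonneg measurableSet_Ioi fun x _ => sq_nonneg _
    obtain ⟨b, hab, -, hb⟩ := H.exists_mul_sq_le ha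
      (show 0 < (A + 1) / ε ^ 2 by positivity)
    have hbε : u b ≤ ε := by
      rw [div_mul_eq_mul_div, div_le_iff₀ (by positivity)] at hb
      exact (pow_le_pow_iff_left₀ (H.nonneg b) hε.le two_ne_zero).1
        (le_of_mul_le_mul_left hb (by positivity))
    have h1 := H.action_sub_le_energy hp ht hu ha hab
    have h2 : ∫ x in Ioc a b, (t ^ 2 * h x ^ 2 + (u x ^ 2 - u x ^ (p + 1))) ≤
        ∫ x in Ioi a, (t ^ 2 * h x ^ 2 + (u x ^ 2 - u x ^ (p + 1))) := by
      refine setIntegral_mono_set ((H.integrable_energy hp t).mono_set hsub) ?_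
        Ioc_subset_Ioi_self.eventuallyLE
      refine (ae_restrict_iff' measurableSet_Ioi).2 (Filter.Eventually.of_forall fun x hx => ?_)
      exact H.energy_nonneg hp t (hu x (hsub hx : (0 : ℝ) < x).le)
    refine le_trans (mul_le_mul_of_nonneg_left ?_ (by linarith)) (h1.trans h2)
    have h3 := monotone_solitonAction hp hbε
    rw [abs_sub_comm]
    refine le_trans ?_ (le_abs_self _)
    linarith
  have hc : Continuous fun ε => 2 * t * (solitonAction p (u a) - solitonAction p ε) :=
    continuous_const.mul (continuous_const.sub (continuous_solitonAction hp))
  have hlim := (hc.tendsto 0).mono_left (nhdsWithin_le_nhds (s := Ioi 0))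
  rw [solitonAction_zero, sub_zero] at hlim
  exact le_of_tendsto hlim (by filter_upwards [self_mem_nhdsWithin] with ε hε using key ε hε)

end ControlledOnHalfLine

/-- On a star graph with at least two edges every level below `u k x` is attained on both sides of
the point `x` of the edge `k`. -/
theorem action_le_star_energy {N : ℕ} (hN : 2 ≤ N) {p t : ℝ} (hp : 1 < p) (ht : 0 ≤ t)
    {u h : Fin N → ℝ → ℝ} (H : ∀ k, ControlledOnHalfLine (u k) (h k))
    (hv : ∀ j k, u j 0 = u k 0) (hu : ∀ k x, 0 ≤ x → u k x ≤ 1) (k : Fin N) {x : ℝ} (hx : 0 ≤ x) :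
    4 * t * solitonAction p (u k x) ≤
      ∑ j, ∫ x in Ioi 0, (t ^ 2 * h j x ^ 2 + (u j x ^ 2 - u j x ^ (p + 1))) := by
  set E : Fin N → ℝ → ℝ := fun j x => t ^ 2 * h j x ^ 2 + (u j x ^ 2 - u j x ^ (p + 1)) with hE
  have E0 : ∀ j, 0 ≤ ∫ x in Ioi 0, E j x := fun j =>
    setIntegral_nonneg measurableSet_Ioi fun x hx =>
      (H j).energy_nonneg hp t (hu j x (show (0 : ℝ) < x from hx).le)
  have : Nontrivial (Fin N) := Fin.nontrivial_iff_two_le.2 hN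
  -- The three disjoint pieces, from x to infinity, from x to the vertex, and from the vertex to
  -- infinity on edge j, cost at least 2t times S(u x), S(u x) − S(u 0) and S(u 0), with S the
  -- action. The vertex values cancel.
  obtain ⟨j, hj⟩ := exists_ne k
  have h1 : (∫ x in Ioi 0, E k x) + ∫ x in Ioi 0, E j x ≤ ∑ j, ∫ x in Ioi 0, E j x := by
    rw [← Finset.sum_pair (f := fun i => ∫ x in Ioi 0, E i x) hj.symm]
    exact Finset.sum_le_sum_of_subset_of_nonneg (Finset.subset_univ _) fun i _ _ => E0 i
  have h2 : ∫ x in Ioi 0, E k x = (∫ y in Ioc 0 x, E k y) + ∫ y in Ioi x, E k y := by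
    rw [← Ioc_union_Ioi_eq_Ioi hx]
    have hi := (H k).integrable_energy hp t
    refine setIntegral_union (Ioc_disjoint_Ioi le_rfl) measurableSet_Ioi
      (hi.mono_set Ioc_subset_Ioi_self) (hi.mono_set (Ioi_subset_Ioi hx))
  have h3 := (H k).action_sub_le_energy hp ht (hu k) le_rfl hx
  have h4 := (H k).action_le_energy hp ht (hu k) hx
  have h5 := (H j).action_le_energy hp ht (hu j) le_rfl
  rw [hv j k] at h5
  have h6 := mul_le_mul_of_nonneg_left (le_abs_self (solitonAction p (u k x) -
    solitonAction p (u k 0))) (show 0 ≤ 2 * t by linarith)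
  change _ ≤ ∑ j, ∫ x in Ioi 0, E j x
  linarith

/-! ### Optimization and the inequality on star graphs -/

/-- The sharp Gagliardo–Nirenberg constant, with `α = (p - 1) / 4`. -/
noncomputable def sharpGN (p : ℝ) : ℝ :=
  ((p - 1) / 4 / (2 * solitonAction p 1) ^ 2) ^ ((p - 1) / 4) /
    (1 + (p - 1) / 4) ^ (1 + (p - 1) / 4)

theorem sharpGN_nonneg {p : ℝ} (hp : 1 < p) : 0 ≤ sharpGN p := by
  unfold sharpGN
  have : 0 < (p - 1) / 4 := by linarith
  positivity

/-- AM–GM for a − z and z/α with weights 1/(1+α) and α/(1+α), chosen so that z drops out of the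
arithmetic mean. -/
theorem sub_mul_rpow_le {α a z : ℝ} (hα : 0 < α) (hz : 0 < z) (hza : z ≤ a) :
    (a - z) * (z / α) ^ α ≤ a ^ (1 + α) / (1 + α) ^ (1 + α) := by
  have h1 := Real.geom_mean_le_arith_mean2_weighted (w₁ := 1 / (1 + α)) (w₂ := α / (1 + α))
    (p₁ := a - z) (p₂ := z / α) (by positivity) (by positivity) (by linarith) (by positivity)
    (by field_simp)
  have h2 : 1 / (1 + α) * (a - z) + α / (1 + α) * (z / α) = a / (1 + α) := by
    field_simp; ring
  rw [h2] at h1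
  have h3 := Real.rpow_le_rpow (mul_nonneg (Real.rpow_nonneg (by linarith) _)
    (Real.rpow_nonneg (by positivity) _)) h1 (show 0 ≤ 1 + α by linarith)
  rw [Real.mul_rpow (Real.rpow_nonneg (by linarith) _) (Real.rpow_nonneg (by positivity) _),
    ← Real.rpow_mul (by linarith), ← Real.rpow_mul (by positivity),
    div_mul_cancel₀ _ (by positivity), div_mul_cancel₀ _ (by positivity), Real.rpow_one,
    Real.div_rpow (x := a) (by linarith) (by linarith)] at h3
  exact h3

/-- Optimization of the energy inequality with respect to the scale `t`. -/
theorem le_sharpGN_of_forall_scale {p a d π : ℝ} (hp : 1 < p) (ha : 0 ≤ a) (hd : 0 ≤ d)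
    (hπ : 0 ≤ π)
    (hall : ∀ t, 0 ≤ t → 4 * t * solitonAction p 1 ≤ t ^ 2 * d + (a - π)) :
    0 < d ∧ π ≤ sharpGN p * (a ^ (1 + (p - 1) / 4) * d ^ ((p - 1) / 4)) := by
  have hK := solitonAction_one_pos hp
  set K := solitonAction p 1 with hKdef
  set α := (p - 1) / 4 with hα
  have hα0 : 0 < α := by rw [hα]; linarith
  have hd0 : 0 < d := by
    refine lt_of_le_of_ne hd fun h0 => ?_
    -- With d = 0 this t would give a + 1 ≤ a − π.
    have := hall ((a + 1) / (4 * K)) (by positivity)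
    rw [← h0, mul_zero, zero_add, mul_assoc, div_mul_eq_mul_div, ← mul_div_assoc,
      mul_left_comm, mul_div_assoc, div_self (by positivity)] at this
    linarith
  refine ⟨hd0, ?_⟩
  -- This t maximises 4tK − t²d; the maximum is z = (2K)²/d, so z ≤ a − π.
  have h1 := hall (2 * K / d) (by positivity)
  have h2 : 4 * (2 * K / d) * K = 2 * ((2 * K) ^ 2 / d) := by ring
  have h3 : (2 * K / d) ^ 2 * d = (2 * K) ^ 2 / d := by field_simp
  rw [h2, h3] at h1
  set z := (2 * K) ^ 2 / d with hz
  have hz0 : 0 < z := by positivity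
  have h4 := sub_mul_rpow_le (a := a) hα0 hz0 (by linarith)
  have h5 : 0 < (z / α) ^ α := by positivity
  have h6 : (z / α) ^ α * (α / (2 * K) ^ 2) ^ α * d ^ α = 1 := by
    rw [← Real.mul_rpow (by positivity) (by positivity),
      ← Real.mul_rpow (by positivity) (by positivity)]
    have : z / α * (α / (2 * K) ^ 2) * d = 1 := by rw [hz]; field_simp
    rw [this, Real.one_rpow]
  have h7 : π ≤ a - z := by linarith
  calc π ≤ (a - z) * ((z / α) ^ α * (α / (2 * K) ^ 2) ^ α * d ^ α) := by rw [h6, mul_one]; exact h7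
    _ = ((a - z) * (z / α) ^ α) * ((α / (2 * K) ^ 2) ^ α * d ^ α) := by ring
    _ ≤ (a ^ (1 + α) / (1 + α) ^ (1 + α)) * ((α / (2 * K) ^ 2) ^ α * d ^ α) :=
        mul_le_mul_of_nonneg_right h4 (by positivity)
    _ = sharpGN p * (a ^ (1 + α) * d ^ α) := by rw [sharpGN]; ring

open Filter Topology in
/-- The Gagliardo–Nirenberg inequality with the sharp constant on star graphs with at least two
edges. -/
theorem star_gagliardo_nirenberg {N : ℕ} (hN : 2 ≤ N) {p : ℝ} (hp : 1 < p)
    {u h : Fin N → ℝ → ℝ} (H : ∀ k, ControlledOnHalfLine (u k) (h k))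
    (hv : ∀ j k, u j 0 = u k 0) :
    ∑ k, ∫ x in Ioi 0, u k x ^ (p + 1) ≤ sharpGN p *
      ((∑ k, ∫ x in Ioi 0, u k x ^ 2) ^ (1 + (p - 1) / 4) *
        (∑ k, ∫ x in Ioi 0, h k x ^ 2) ^ ((p - 1) / 4)) := by
  set α := (p - 1) / 4 with hα
  have hα0 : 0 < α := by rw [hα]; linarith
  set A := ∑ k, ∫ x in Ioi 0, u k x ^ 2 with hA
  set D := ∑ k, ∫ x in Ioi 0, h k x ^ 2 with hD
  set P := ∑ k, ∫ x in Ioi 0, u k x ^ (p + 1) with hP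
  have hA0 : 0 ≤ A := Finset.sum_nonneg fun k _ =>
    setIntegral_nonneg measurableSet_Ioi fun x _ => sq_nonneg _
  have hD0 : 0 ≤ D := Finset.sum_nonneg fun k _ =>
    setIntegral_nonneg measurableSet_Ioi fun x _ => sq_nonneg _
  have hP0 : 0 ≤ P := Finset.sum_nonneg fun k _ =>
    setIntegral_nonneg measurableSet_Ioi fun x _ => Real.rpow_nonneg ((H k).nonneg x) _
  have hRHS : 0 ≤ sharpGN p * (A ^ (1 + α) * D ^ α) :=
    mul_nonneg (sharpGN_nonneg hp) (by positivity)
  set S : Set ℝ := ⋃ k, u k '' Ici 0 with hS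
  have hSb : BddAbove S := by
    rw [hS, ← biUnion_univ, finite_univ.bddAbove_biUnion]
    intro k _
    obtain ⟨B, hB⟩ := (H k).exists_le
    exact ⟨B, by rintro _ ⟨x, hx, rfl⟩; exact hB x hx⟩
  have hle : ∀ k x, 0 ≤ x → u k x ≤ sSup S := fun k x hx =>
    le_csSup hSb (mem_iUnion.2 ⟨k, x, hx, rfl⟩)
  have k₀ : Fin N := ⟨0, by omega⟩
  have hSne : S.Nonempty := ⟨u k₀ 0, mem_iUnion.2 ⟨k₀, 0, self_mem_Ici, rfl⟩⟩
  have hM0 : 0 ≤ sSup S := ((H k₀).nonneg 0).trans (hle k₀ 0 le_rfl)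
  rcases hM0.eq_or_lt with hM | hM
  · have : P = 0 := by
      refine Finset.sum_eq_zero fun k _ => setIntegral_eq_zero_of_forall_eq_zero fun x hx => ?_
      have : u k x = 0 :=
        le_antisymm (hM ▸ hle k x (show (0 : ℝ) < x from hx).le) ((H k).nonneg x)
      rw [this, Real.zero_rpow (by linarith)]
    rw [this]
    exact hRHS
  set M := sSup S with hMdef
  set c := M⁻¹ with hc
  have hc0 : 0 < c := inv_pos.2 hM
  have Hc : ∀ k, ControlledOnHalfLine (fun x => c * u k x) (fun x => c * h k x) := fun k =>
    (H k).const_mul hc0.le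
  have hu1 : ∀ k x, 0 ≤ x → c * u k x ≤ 1 := fun k x hx => by
    rw [hc, inv_mul_le_one₀ hM]
    exact hle k x hx
  have hall : ∀ t, 0 ≤ t →
      4 * t * solitonAction p 1 ≤ t ^ 2 * (c ^ 2 * D) + (c ^ 2 * A - c ^ (p + 1) * P) := by
    intro t ht
    have e : ∑ j, ∫ x in Ioi 0, (t ^ 2 * (c * h j x) ^ 2 +
        ((c * u j x) ^ 2 - (c * u j x) ^ (p + 1))) =
        t ^ 2 * (c ^ 2 * D) + (c ^ 2 * A - c ^ (p + 1) * P) := by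
      rw [hD, hA, hP, Finset.mul_sum, Finset.mul_sum, Finset.mul_sum, Finset.mul_sum,
        ← Finset.sum_sub_distrib, ← Finset.sum_add_distrib]
      refine Finset.sum_congr rfl fun j _ => ?_
      have i1 := ((Hc j).integrable_bound_sq.const_mul (t ^ 2))
      have i2 := (Hc j).integrable_sq
      have i3 := (Hc j).integrable_rpow (q := p + 1) (by linarith)
      rw [integral_add i1 (by exact i2.sub i3), integral_sub i2 i3, integral_const_mul]
      simp only [mul_pow, Real.mul_rpow hc0.le ((H j).nonneg _), integral_const_mul]
    rw [← e]
    -- Whether the supremum is attained does not matter: take points at height at least r < 1, then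
    -- let r → 1.
    have step : ∀ r, r < 1 → 4 * t * solitonAction p r ≤ ∑ j, ∫ x in Ioi 0,
        (t ^ 2 * (c * h j x) ^ 2 + ((c * u j x) ^ 2 - (c * u j x) ^ (p + 1))) := by
      intro r hr
      obtain ⟨s, hs, hrs⟩ := exists_lt_of_lt_csSup hSne
        (show r * M < M by nlinarith)
      obtain ⟨k, x, hx, rfl⟩ := mem_iUnion.1 hs
      refine le_trans (mul_le_mul_of_nonneg_left (monotone_solitonAction hp ?_) (by linarith))
        (action_le_star_energy hN hp ht Hc (fun j k => by rw [hv j k]) hu1 k hx)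
      rw [hc, ← div_eq_inv_mul, le_div_iff₀ hM]
      exact hrs.le
    have hcont : Continuous fun r => 4 * t * solitonAction p r :=
      continuous_const.mul (continuous_solitonAction hp)
    refine le_of_tendsto ((hcont.tendsto 1).mono_left (nhdsWithin_le_nhds (s := Iio 1))) ?_
    filter_upwards [self_mem_nhdsWithin] with r hr using step r hr
  have hfin := (le_sharpGN_of_forall_scale hp (by positivity) (by positivity)
    (by positivity) hall).2
  rw [← hα, Real.mul_rpow (by positivity) hA0, Real.mul_rpow (by positivity) hD0] at hfin
  -- The scaling cancels because 2(1 + α) + 2α = p + 1.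
  have hpow : (c ^ 2) ^ (1 + α) * (c ^ 2) ^ α = c ^ (p + 1) := by
    rw [← Real.rpow_natCast c 2, ← Real.rpow_mul hc0.le, ← Real.rpow_mul hc0.le,
      ← Real.rpow_add hc0]
    congr 1
    rw [hα]; push_cast; ring
  have hcp : 0 < c ^ (p + 1) := by positivity
  refine le_of_mul_le_mul_left (hfin.trans_eq ?_) hcp
  rw [← hpow]; ring

/-! ### Extended norms as real integrals -/

section norms

theorem lineNorm_rpow {I : Set ℝ} {q : ℝ} (hq : 0 < q) {f : ℝ → ℂ}
    (hf : IntegrableOn (fun x => ‖f x‖ ^ q) I) :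
    lineNorm I q f ^ q = ENNReal.ofReal (∫ x in I, ‖f x‖ ^ q) := by
  rw [lineNorm, eLpNorm_eq_lintegral_rpow_enorm_toReal (by simpa using hq) ENNReal.ofReal_ne_top,
    ENNReal.toReal_ofReal hq.le, ← ENNReal.rpow_mul, one_div, inv_mul_cancel₀ hq.ne',
    ENNReal.rpow_one,
    ofReal_integral_eq_lintegral_ofReal hf (Filter.Eventually.of_forall fun x => by positivity)]
  refine lintegral_congr fun x => ?_
  rw [← ENNReal.ofReal_rpow_of_nonneg (norm_nonneg _) hq.le, ofReal_norm]

theorem lineNorm_two_rpow {I : Set ℝ} {f : ℝ → ℂ} (hf : IntegrableOn (fun x => ‖f x‖ ^ 2) I)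
    (r : ℝ) : lineNorm I 2 f ^ r = ENNReal.ofReal (∫ x in I, ‖f x‖ ^ 2) ^ (r / 2) := by
  have := lineNorm_rpow (I := I) (q := 2) two_pos (f := f) (by simpa using hf)
  simp only [Real.rpow_two] at this
  rw [← this, ← ENNReal.rpow_mul]
  congr 1; ring

theorem graphNorm_rpow {N : ℕ} {q : ℝ} (hq : 0 < q) {f : Fin N → ℝ → ℂ}
    (hf : ∀ k, IntegrableOn (fun x => ‖f k x‖ ^ q) (Ioi 0)) :
    graphNorm q f ^ q = ENNReal.ofReal (∑ k, ∫ x in Ioi 0, ‖f k x‖ ^ q) := by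
  rw [graphNorm, ← ENNReal.rpow_mul, one_div, inv_mul_cancel₀ hq.ne', ENNReal.rpow_one,
    ENNReal.ofReal_sum_of_nonneg fun k _ => integral_nonneg fun x => by positivity]
  exact Finset.sum_congr rfl fun k _ => lineNorm_rpow hq (hf k)

theorem graphNorm_two_rpow {N : ℕ} {f : Fin N → ℝ → ℂ}
    (hf : ∀ k, IntegrableOn (fun x => ‖f k x‖ ^ 2) (Ioi 0)) (r : ℝ) :
    graphNorm 2 f ^ r = ENNReal.ofReal (∑ k, ∫ x in Ioi 0, ‖f k x‖ ^ 2) ^ (r / 2) := by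
  have := graphNorm_rpow (q := 2) two_pos (f := f) (by simpa using hf)
  simp only [Real.rpow_two] at this
  rw [← this, ← ENNReal.rpow_mul]
  congr 1; ring

theorem graphNorm_graphDeriv_le_graphHdotNorm {N : ℕ} [NeZero N] (γ : ℝ) (f : Fin N → ℝ → ℂ) :
    graphNorm 2 (graphDeriv f) ≤ graphHdotNorm γ f := by
  rw [graphHdotNorm, one_div, ENNReal.le_rpow_inv_iff two_pos]
  exact le_self_add

end norms

/-! ### From Sobolev functions to controlled functions -/

section sobolev

variable {I : Set ℝ} {f g : ℝ → ℂ}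

theorem MemH1.hasWeakDeriv (h : MemH1 I f) : HasWeakDeriv I f (weakDeriv I f) := by
  obtain ⟨-, g, hg, -⟩ := h
  have h : ∃ g, HasWeakDeriv I f g := ⟨g, hg⟩
  rw [weakDeriv, dif_pos h]
  exact h.choose_spec

theorem MemH1.memLp_weakDeriv (hI : IsOpen I) (h : MemH1 I f) :
    MemLp (weakDeriv I f) 2 (volume.restrict I) := by
  obtain ⟨-, g, hg, hg2⟩ := h
  exact hg2.ae_eq (hg.weakDeriv_ae_eq hI).symm

theorem MeasureTheory.MemLp.integrableOn_norm_sq (h : MemLp f 2 (volume.restrict I)) :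
    IntegrableOn (fun x => ‖f x‖ ^ 2) I := by
  have := h.integrable_norm_rpow two_ne_zero ENNReal.ofNat_ne_top
  simpa [IntegrableOn] using this

theorem MeasureTheory.MemLp.intervalIntegrable_of_Ioi
    (h : MemLp g 2 (volume.restrict (Ioi 0))) {a b : ℝ} (ha : 0 ≤ a) (hb : 0 ≤ b) :
    IntervalIntegrable g volume a b := by
  have hsub : uIoc a b ⊆ Ioi 0 := fun x hx => (le_min ha hb).trans_lt hx.1
  rw [intervalIntegrable_iff]
  have : IsFiniteMeasure (volume.restrict (uIoc a b)) := ⟨by simp [uIoc]⟩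
  exact (h.mono_measure (Measure.restrict_mono hsub le_rfl)).integrable one_le_two

theorem controlledOnHalfLine_of_eq_primitive (hf : MemLp f 2 (volume.restrict (Ioi 0)))
    (hg : MemLp g 2 (volume.restrict (Ioi 0))) {x₀ : ℝ} (hx₀ : 0 ≤ x₀) {c : ℂ}
    (hfg : ∀ x, 0 ≤ x → f x = c + ∫ t in x₀..x, g t) :
    ControlledOnHalfLine (fun x => ‖f x‖) (fun x => ‖g x‖) := by
  have hsub : ∀ x y, 0 ≤ x → 0 ≤ y → f y - f x = ∫ t in x..y, g t := by
    intro x y hx hy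
    rw [hfg x hx, hfg y hy, add_sub_add_left_eq_sub, intervalIntegral.integral_interval_sub_left
      (hg.intervalIntegrable_of_Ioi hx₀ hy) (hg.intervalIntegrable_of_Ioi hx₀ hx)]
  have hle : ∀ x y, 0 ≤ x → x ≤ y → |‖f y‖ - ‖f x‖| ≤ ∫ t in x..y, ‖g t‖ := by
    intro x y hx hxy
    refine (abs_norm_sub_norm_le _ _).trans ?_
    rw [hsub x y hx (hx.trans hxy)]
    exact intervalIntegral.norm_integral_le_integral_norm hxy
  refine ⟨?_, fun x => norm_nonneg _, fun x => norm_nonneg _, hg.1.norm,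
    hf.integrableOn_norm_sq, hg.integrableOn_norm_sq, hle⟩
  refine ContinuousOn.norm ?_
  intro x hx
  have h1 : ContinuousOn (fun y => c + ∫ t in x₀..y, g t) (uIcc 0 (max x₀ x + 1)) :=
    continuousOn_const.add (intervalIntegral.continuousOn_primitive_interval'
      (hg.intervalIntegrable_of_Ioi le_rfl (by positivity))
      (by rw [uIcc_of_le (by positivity)]
          exact ⟨hx₀, (le_max_left _ _).trans (by linarith)⟩))
  rw [uIcc_of_le (by positivity)] at h1
  have hx' : x < max x₀ x + 1 := (le_max_right _ _).trans_lt (by linarith)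
  have h2 : ContinuousWithinAt (fun y => c + ∫ t in x₀..y, g t) (Ici 0) x := by
    refine (h1 x ⟨hx, hx'.le⟩).mono_of_mem_nhdsWithin ?_
    rw [← Ici_inter_Iic]
    exact Filter.inter_mem self_mem_nhdsWithin (mem_nhdsWithin_of_mem_nhds (Iic_mem_nhds hx'))
  exact h2.congr (fun y hy => hfg y hy) (hfg x hx)

/-- The primitive must be based inside the open half-line, here at 1. Continuity turns the almost
everywhere identity into a pointwise one on (0, ∞), and a one-sided limit extends it to the vertex.
-/
theorem MemH1.controlledOnHalfLine (h : MemH1 (Ioi 0) f) (hc : ContinuousOn f (Ici 0)) :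
    ControlledOnHalfLine (fun x => ‖f x‖) (fun x => ‖weakDeriv (Ioi 0) f x‖) := by
  obtain ⟨c, hcf⟩ := h.hasWeakDeriv.exists_ae_eq_primitive isOpen_Ioi ordConnected_Ioi
    (mem_Ioi.2 one_pos)
  have hg := h.memLp_weakDeriv isOpen_Ioi
  set g := weakDeriv (Ioi 0) f
  have hF : ContinuousOn (fun x => c + ∫ t in (1 : ℝ)..x, g t) (Ioi 0) :=
    continuousOn_const.add (continuousOn_primitive_of_locallyIntegrableOn isOpen_Ioi
      ordConnected_Ioi (mem_Ioi.2 one_pos) h.hasWeakDeriv.locallyIntegrableOn_deriv)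
  have e1 : EqOn f (fun x => c + ∫ t in (1 : ℝ)..x, g t) (Ioi 0) :=
    Measure.eqOn_open_of_ae_eq ((ae_restrict_iff' measurableSet_Ioi).2 hcf) isOpen_Ioi
      (hc.mono Ioi_subset_Ici_self) hF
  refine controlledOnHalfLine_of_eq_primitive (x₀ := 1) (c := c) h.1 hg zero_le_one fun x hx => ?_
  rcases hx.eq_or_lt with rfl | hx
  · have l1 : ContinuousWithinAt f (Ioi 0) 0 :=
      (hc 0 self_mem_Ici).mono Ioi_subset_Ici_self
    have l2 : ContinuousWithinAt (fun x => c + ∫ t in (1 : ℝ)..x, g t) (Ioi 0) 0 := by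
      have := intervalIntegral.continuousOn_primitive_interval'
        (hg.intervalIntegrable_of_Ioi le_rfl zero_le_one) (right_mem_uIcc (a := (0 : ℝ)) (b := 1))
      have := continuousOn_const (c := c) |>.add this
      rw [uIcc_of_le zero_le_one] at this
      refine (this 0 ⟨le_rfl, zero_le_one⟩).mono_of_mem_nhdsWithin ?_
      exact Icc_mem_nhdsGT zero_lt_one
    refine tendsto_nhds_unique l1 (l2.tendsto.congr' ?_)
    filter_upwards [self_mem_nhdsWithin] with x hx using (e1 hx).symm
  · exact e1 hx

/-- A continuously differentiable function has its derivative as weak derivative. -/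
theorem hasWeakDeriv_of_hasDerivAt (I : Set ℝ) (hf : ∀ x, HasDerivAt f (g x) x)
    (hg : Continuous g) : HasWeakDeriv I f g := by
  have hfc : Continuous f := continuous_iff_continuousAt.2 fun x => (hf x).continuousAt
  refine ⟨hfc.locallyIntegrable.locallyIntegrableOn I,
    hg.locallyIntegrable.locallyIntegrableOn I, fun φ hφ hc hs => ?_⟩
  have hφ' : Continuous (deriv φ) := hφ.continuous_deriv (by exact_mod_cast le_top)
  have hz : ∀ x ∉ I, φ x = 0 := fun x hx => image_eq_zero_of_notMem_tsupport fun h => hx (hs h)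
  have hz' : ∀ x ∉ I, deriv φ x = 0 := fun x hx =>
    image_eq_zero_of_notMem_tsupport fun h => hx (hs (tsupport_deriv_subset (𝕜 := ℝ) h))
  rw [setIntegral_eq_integral_of_forall_compl_eq_zero fun x hx => by rw [hz' x hx, zero_smul],
    setIntegral_eq_integral_of_forall_compl_eq_zero fun x hx => by rw [hz x hx, zero_smul]]
  have i1 : Integrable fun x => φ x • g x :=
    (hφ.continuous.smul hg).integrable_of_hasCompactSupport hc.smul_right
  have i2 : Integrable fun x => deriv φ x • f x :=
    (hφ'.smul hfc).integrable_of_hasCompactSupport hc.deriv.smul_right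
  have i3 : Integrable fun x => φ x • f x :=
    (hφ.continuous.smul hfc).integrable_of_hasCompactSupport hc.smul_right
  have hd : ∀ x, HasDerivAt (fun x => φ x • f x) (φ x • g x + deriv φ x • f x) x := fun x =>
    ((hφ.differentiable (by simp)) x).hasDerivAt.smul (hf x)
  have := integral_eq_zero_of_hasDerivAt_of_integrable hd (i1.add i2) i3
  rw [integral_add i1 i2] at this
  exact eq_neg_of_add_eq_zero_right this

end sobolev

/-! ### The sharp constant is admissible -/

section upper

variable {p : ℝ}

theorem ofReal_le_of_le_sharpGN (hp : 1 < p) {C : ℝ≥0} (hC : sharpGN p ≤ C) {A D P : ℝ}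
    (hA : 0 ≤ A) (hD : 0 ≤ D)
    (hP : P ≤ sharpGN p * (A ^ (1 + (p - 1) / 4) * D ^ ((p - 1) / 4))) :
    ENNReal.ofReal P ≤ C * ENNReal.ofReal A ^ ((p + 3) / 2 / 2) *
      ENNReal.ofReal D ^ ((p - 1) / 2 / 2) := by
  have e1 : (p + 3) / 2 / 2 = 1 + (p - 1) / 4 := by ring
  have e2 : (p - 1) / 2 / 2 = (p - 1) / 4 := by ring
  rw [e1, e2, ENNReal.ofReal_rpow_of_nonneg hA (by linarith),
    ENNReal.ofReal_rpow_of_nonneg hD (by linarith), ← ENNReal.ofReal_coe_nnreal,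
    ← ENNReal.ofReal_mul C.coe_nonneg, ← ENNReal.ofReal_mul (by positivity)]
  refine ENNReal.ofReal_le_ofReal (hP.trans ?_)
  rw [mul_assoc]
  exact mul_le_mul_of_nonneg_right hC (by positivity)

theorem mem_graphGNConstants {N : ℕ} [NeZero N] (hN : 2 ≤ N) (hp : 1 < p) (γ : ℝ) {C : ℝ≥0}
    (hC : sharpGN p ≤ C) : C ∈ graphGNConstants N γ p := by
  intro f hf
  have H : ∀ k, ControlledOnHalfLine (fun x => ‖f k x‖) (fun x => ‖graphDeriv f k x‖) :=
    fun k => (hf.memH1 k).controlledOnHalfLine (hf.continuousOn k)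
  have key := star_gagliardo_nirenberg hN hp H fun j k => by rw [hf.vertex j k]
  have h1 := graphNorm_rpow (q := p + 1) (by linarith) fun k =>
    (H k).integrable_rpow (q := p + 1) (by linarith)
  have h2 := graphNorm_two_rpow (fun k => (H k).integrable_sq) ((p + 3) / 2)
  have h3 := graphNorm_two_rpow (fun k => (H k).integrable_bound_sq) ((p - 1) / 2)
  have h4 := ofReal_le_of_le_sharpGN hp hC
    (Finset.sum_nonneg fun k _ => integral_nonneg fun x => by positivity)
    (Finset.sum_nonneg fun k _ => integral_nonneg fun x => by positivity) key
  rw [h1, h2]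
  refine h4.trans ?_
  refine mul_le_mul_right ?_ _
  refine h3.symm.le.trans ?_
  exact ENNReal.rpow_le_rpow (graphNorm_graphDeriv_le_graphHdotNorm γ f) (by linarith)

theorem integral_eq_Ioi_add_Ioi_neg {F : ℝ → ℝ} (hF : Integrable F) :
    ∫ x, F x = (∫ x in Ioi 0, F x) + ∫ x in Ioi 0, F (-x) := by
  rw [integral_comp_neg_Ioi, neg_zero, add_comm, intervalIntegral.integral_Iic_add_Ioi
    hF.integrableOn hF.integrableOn]

theorem integrable_of_Ioi_of_neg {F : ℝ → ℝ} (h1 : IntegrableOn F (Ioi 0))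
    (h2 : IntegrableOn (fun x => F (-x)) (Ioi 0)) : Integrable F := by
  rw [← integrableOn_univ, ← Iic_union_Ioi (a := (0 : ℝ))]
  refine IntegrableOn.union ?_ h1
  rw [integrableOn_Iic_iff_integrableOn_Iio]
  rw [← (Measure.measurePreserving_neg volume).integrableOn_comp_preimage
    (Homeomorph.neg ℝ).measurableEmbedding, neg_preimage, neg_Iio, neg_zero]
  exact h2

/-- The line is a star with two edges: fold the continuous representative F at 0 into F(x) and
F(−x). -/
theorem mem_lineGNConstants (hp : 1 < p) {C : ℝ≥0} (hC : sharpGN p ≤ C) :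
    C ∈ lineGNConstants p := by
  intro f hf
  obtain ⟨c, hc⟩ := hf.hasWeakDeriv.exists_ae_eq_primitive isOpen_univ ordConnected_univ
    (mem_univ 0)
  have hg := hf.memLp_weakDeriv isOpen_univ
  set g := weakDeriv univ f
  set F : ℝ → ℂ := fun x => c + ∫ t in (0 : ℝ)..x, g t with hFdef
  have hfF : f =ᵐ[volume.restrict univ] F := by
    rw [Measure.restrict_univ]
    filter_upwards [hc] with x hx using hx trivial
  have hF := hf.1.ae_eq hfF
  rw [lineNorm, lineNorm, eLpNorm_congr_ae hfF, eLpNorm_congr_ae hfF, ← lineNorm, ← lineNorm]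
  have hneg : ∀ {u : ℝ → ℂ}, MemLp u 2 (volume.restrict univ) →
      MemLp (fun x => u (-x)) 2 (volume.restrict (Ioi 0)) := by
    intro u hu
    rw [Measure.restrict_univ] at hu
    exact (hu.comp_measurePreserving (Measure.measurePreserving_neg volume)).restrict _
  have hpos : ∀ {u : ℝ → ℂ}, MemLp u 2 (volume.restrict univ) →
      MemLp u 2 (volume.restrict (Ioi 0)) := fun hu =>
    hu.mono_measure (Measure.restrict_mono (subset_univ _) le_rfl)
  have H0 : ControlledOnHalfLine (fun x => ‖F x‖) (fun x => ‖g x‖) :=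
    controlledOnHalfLine_of_eq_primitive (hpos hF) (hpos hg) le_rfl fun x _ => rfl
  have H1 : ControlledOnHalfLine (fun x => ‖F (-x)‖) (fun x => ‖-g (-x)‖) :=
    controlledOnHalfLine_of_eq_primitive (x₀ := 0) (c := c) (hneg hF) (hneg hg).neg le_rfl
      fun x _ => by
        rw [hFdef]
        simp only [intervalIntegral.integral_neg, intervalIntegral.integral_comp_neg, neg_zero]
        rw [intervalIntegral.integral_symm]
  simp only [norm_neg] at H1
  have key := star_gagliardo_nirenberg (N := 2) le_rfl hp
    (u := ![fun x => ‖F x‖, fun x => ‖F (-x)‖]) (h := ![fun x => ‖g x‖, fun x => ‖g (-x)‖])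
    (by rw [Fin.forall_fin_two]; exact ⟨H0, H1⟩) (by simp [Fin.forall_fin_two])
  have iF := hF.integrableOn_norm_sq
  have ig := hg.integrableOn_norm_sq
  have iP : IntegrableOn (fun x => ‖F x‖ ^ (p + 1)) univ :=
    (integrable_of_Ioi_of_neg (H0.integrable_rpow (by linarith))
      (H1.integrable_rpow (by linarith))).integrableOn
  simp only [Fin.sum_univ_two, Matrix.cons_val_zero, Matrix.cons_val_one] at key
  rw [← integral_eq_Ioi_add_Ioi_neg (F := fun x => ‖F x‖ ^ (p + 1)) (integrableOn_univ.1 iP),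
    ← integral_eq_Ioi_add_Ioi_neg (F := fun x => ‖F x‖ ^ 2) (integrableOn_univ.1 iF),
    ← integral_eq_Ioi_add_Ioi_neg (F := fun x => ‖g x‖ ^ 2) (integrableOn_univ.1 ig)] at key
  rw [lineNorm_rpow (by linarith) iP, lineNorm_two_rpow iF, lineNorm_two_rpow ig]
  simp only [Measure.restrict_univ]
  exact ofReal_le_of_le_sharpGN hp hC (integral_nonneg fun x => by positivity)
    (integral_nonneg fun x => by positivity) key

end upper

/-! ### The soliton and its integrals -/

/-- The soliton of height one, an optimizer of the Gagliardo–Nirenberg inequality on the line. -/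
noncomputable def soliton (p x : ℝ) : ℝ := Real.cosh ((p - 1) / 2 * x) ^ (-(2 / (p - 1)))

/-- The derivative of `soliton p`. -/
noncomputable def solitonDeriv (p x : ℝ) : ℝ :=
  -(Real.sinh ((p - 1) / 2 * x) / Real.cosh ((p - 1) / 2 * x) * soliton p x)

section soliton

variable {p : ℝ}

theorem soliton_pos (p x : ℝ) : 0 < soliton p x := Real.rpow_pos_of_pos (Real.cosh_pos _) _

@[simp] theorem soliton_neg (p x : ℝ) : soliton p (-x) = soliton p x := by
  simp [soliton]

@[simp] theorem solitonDeriv_neg (p x : ℝ) : solitonDeriv p (-x) = -solitonDeriv p x := by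
  simp [solitonDeriv, neg_div]

@[simp] theorem soliton_zero (p : ℝ) : soliton p 0 = 1 := by simp [soliton]

theorem soliton_le_one (hp : 1 < p) (x : ℝ) : soliton p x ≤ 1 :=
  Real.rpow_le_one_of_one_le_of_nonpos (Real.one_le_cosh _)
    (neg_nonpos.2 (div_nonneg two_pos.le (by linarith)))

theorem hasDerivAt_soliton (hp : 1 < p) (x : ℝ) :
    HasDerivAt (soliton p) (solitonDeriv p x) x := by
  have hp' : p - 1 ≠ 0 := by linarith
  have h1 : HasDerivAt (fun y => Real.cosh ((p - 1) / 2 * y))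
      (Real.sinh ((p - 1) / 2 * x) * ((p - 1) / 2)) x := by
    simpa using ((hasDerivAt_id x).const_mul ((p - 1) / 2)).cosh
  have h2 := h1.rpow_const (p := -(2 / (p - 1))) (Or.inl (Real.cosh_pos _).ne')
  refine h2.congr_deriv ?_
  rw [solitonDeriv, soliton, Real.rpow_sub_one (Real.cosh_pos _).ne']
  field_simp

theorem continuous_soliton (hp : 1 < p) : Continuous (soliton p) :=
  continuous_iff_continuousAt.2 fun x => (hasDerivAt_soliton hp x).continuousAt

theorem continuous_solitonDeriv (hp : 1 < p) : Continuous (solitonDeriv p) := by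
  have h1 : Continuous fun x => Real.cosh ((p - 1) / 2 * x) :=
    Real.continuous_cosh.comp (by fun_prop)
  have h2 : Continuous fun x => Real.sinh ((p - 1) / 2 * x) :=
    Real.continuous_sinh.comp (by fun_prop)
  exact ((h2.div h1 fun x => (Real.cosh_pos _).ne').mul (continuous_soliton hp)).neg

theorem soliton_rpow (hp : 1 < p) (x : ℝ) :
    soliton p x ^ (p + 1) = soliton p x ^ 2 / Real.cosh ((p - 1) / 2 * x) ^ 2 := by
  have hp' : p - 1 ≠ 0 := by linarith
  have hc := Real.cosh_pos ((p - 1) / 2 * x)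
  rw [soliton, ← Real.rpow_mul hc.le, ← Real.rpow_natCast, ← Real.rpow_natCast,
    ← Real.rpow_mul hc.le, ← Real.rpow_sub hc]
  congr 1
  field_simp
  push_cast
  ring

/-- The first integral of the soliton equation, from cosh² − sinh² = 1. It is the equality case of
the completed square at t = 1. -/
theorem solitonDeriv_sq (hp : 1 < p) (x : ℝ) :
    solitonDeriv p x ^ 2 = soliton p x ^ 2 - soliton p x ^ (p + 1) := by
  have hc := Real.cosh_pos ((p - 1) / 2 * x)
  rw [soliton_rpow hp, solitonDeriv, neg_sq, mul_pow, div_pow, Real.sinh_sq]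
  field_simp

theorem solitonDeriv_eq_neg_momentum (hp : 1 < p) {x : ℝ} (hx : 0 ≤ x) :
    solitonDeriv p x = -solitonMomentum p (soliton p x) := by
  have h : 0 ≤ -solitonDeriv p x := by
    rw [solitonDeriv, neg_neg]
    have hc := Real.cosh_pos ((p - 1) / 2 * x)
    have hs : 0 ≤ Real.sinh ((p - 1) / 2 * x) :=
      Real.sinh_nonneg_iff.2 (mul_nonneg (by linarith) hx)
    have := soliton_pos p x
    positivity
  rw [solitonMomentum, ← solitonDeriv_sq hp, ← neg_sq, Real.sqrt_sq h, neg_neg]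

theorem soliton_le_exp (hp : 1 < p) (x : ℝ) :
    soliton p x ≤ 2 ^ (2 / (p - 1)) * Real.exp (-x) := by
  have hp' : 0 < p - 1 := by linarith
  have h1 : Real.exp ((p - 1) / 2 * x) / 2 ≤ Real.cosh ((p - 1) / 2 * x) := by
    rw [Real.cosh_eq]
    have := Real.exp_pos (-((p - 1) / 2 * x))
    linarith
  refine (Real.rpow_le_rpow_of_nonpos (by positivity) h1 (by
    rw [neg_nonpos]; positivity)).trans_eq ?_
  rw [Real.div_rpow (Real.exp_pos _).le two_pos.le, ← Real.exp_mul, Real.rpow_neg two_pos.le,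
    div_inv_eq_mul, mul_comm]
  congr 2
  field_simp

open Filter Topology in
theorem tendsto_soliton_atTop (hp : 1 < p) : Tendsto (soliton p) atTop (𝓝 0) := by
  have := (Real.tendsto_exp_neg_atTop_nhds_zero).const_mul ((2 : ℝ) ^ (2 / (p - 1)))
  rw [mul_zero] at this
  exact squeeze_zero (fun x => (soliton_pos p x).le) (soliton_le_exp hp) this

theorem integrableOn_soliton_sq (hp : 1 < p) :
    IntegrableOn (fun x => soliton p x ^ 2) (Ioi 0) := by
  refine ((exp_neg_integrableOn_Ioi 0 two_pos).const_mul ((2 ^ (2 / (p - 1))) ^ 2)).mono'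
    ((continuous_soliton hp).pow 2).aestronglyMeasurable (Filter.Eventually.of_forall fun x => ?_)
  rw [Real.norm_eq_abs, abs_of_nonneg (sq_nonneg _)]
  refine (pow_le_pow_left₀ (soliton_pos p x).le (soliton_le_exp hp x) 2).trans_eq ?_
  rw [mul_pow, ← Real.exp_nat_mul]
  congr 2
  push_cast
  ring

theorem soliton_rpow_le (hp : 1 < p) (x : ℝ) : soliton p x ^ (p + 1) ≤ soliton p x ^ 2 := by
  have := solitonDeriv_sq hp x
  nlinarith [sq_nonneg (solitonDeriv p x)]

theorem continuous_soliton_rpow (hp : 1 < p) : Continuous fun x => soliton p x ^ (p + 1) :=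
  (continuous_soliton hp).rpow_const fun x => Or.inl (soliton_pos p x).ne'

theorem integrableOn_soliton_rpow (hp : 1 < p) :
    IntegrableOn (fun x => soliton p x ^ (p + 1)) (Ioi 0) := by
  refine (integrableOn_soliton_sq hp).mono' (continuous_soliton_rpow hp).aestronglyMeasurable
    (Filter.Eventually.of_forall fun x => ?_)
  rw [Real.norm_eq_abs, abs_of_nonneg (Real.rpow_nonneg (soliton_pos p x).le _)]
  exact soliton_rpow_le hp x

theorem integrableOn_solitonDeriv_sq (hp : 1 < p) :
    IntegrableOn (fun x => solitonDeriv p x ^ 2) (Ioi 0) := by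
  simp only [solitonDeriv_sq hp]
  exact (integrableOn_soliton_sq hp).sub (integrableOn_soliton_rpow hp)

/-- On x ≥ 0, Q' = −√(Q² − Q^{p+1}), so Q'² is the derivative of −`solitonAction p` ∘ Q, and Q runs
from 1 down to 0. -/
theorem integral_Ioi_solitonDeriv_sq (hp : 1 < p) :
    ∫ x in Ioi 0, solitonDeriv p x ^ 2 = solitonAction p 1 := by
  have hd : ∀ x ∈ Ici (0 : ℝ), HasDerivAt (fun x => -solitonAction p (soliton p x))
      (solitonDeriv p x ^ 2) x := by
    intro x hx
    refine ((hasDerivAt_solitonAction hp _).comp x (hasDerivAt_soliton hp x)).neg.congr_deriv ?_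
    rw [solitonDeriv_eq_neg_momentum hp hx]
    ring
  have hlim : Filter.Tendsto (fun x => -solitonAction p (soliton p x)) Filter.atTop (nhds 0) := by
    have := (((continuous_solitonAction hp).tendsto 0).comp (tendsto_soliton_atTop hp)).neg
    simpa using this
  rw [integral_Ioi_of_hasDerivAt_of_tendsto' hd (integrableOn_solitonDeriv_sq hp) hlim]
  simp

/-- The stationary equation Q'' = Q − (p+1)/2 · Q^p, with Q^p written as a quotient so that
`soliton_rpow` applies. -/
theorem hasDerivAt_solitonDeriv (hp : 1 < p) (x : ℝ) :
    HasDerivAt (solitonDeriv p) (soliton p x - (p + 1) / 2 * (soliton p x ^ (p + 1) / soliton p x))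
      x := by
  have hc := Real.cosh_pos ((p - 1) / 2 * x)
  have h1 : HasDerivAt (fun y => Real.cosh ((p - 1) / 2 * y))
      (Real.sinh ((p - 1) / 2 * x) * ((p - 1) / 2)) x := by
    simpa using ((hasDerivAt_id x).const_mul ((p - 1) / 2)).cosh
  have h2 : HasDerivAt (fun y => Real.sinh ((p - 1) / 2 * y))
      (Real.cosh ((p - 1) / 2 * x) * ((p - 1) / 2)) x := by
    simpa using ((hasDerivAt_id x).const_mul ((p - 1) / 2)).sinh
  refine ((h2.div h1 hc.ne').mul (hasDerivAt_soliton hp x)).neg.congr_deriv ?_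
  have hs := soliton_pos p x
  rw [soliton_rpow hp, solitonDeriv]
  simp only [Pi.div_apply]
  field_simp
  rw [Real.sinh_sq]
  ring

/-- The Pohozaev identity for the soliton. -/
theorem integral_soliton_identity (hp : 1 < p) :
    (∫ x in Ioi 0, solitonDeriv p x ^ 2) + ∫ x in Ioi 0, soliton p x ^ 2 =
      (p + 1) / 2 * ∫ x in Ioi 0, soliton p x ^ (p + 1) := by
  have iw := integrableOn_solitonDeriv_sq hp
  have is := integrableOn_soliton_sq hp
  have ir := (integrableOn_soliton_rpow hp).const_mul ((p + 1) / 2)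
  -- Integrate (Q Q')' = Q'² + Q Q''; the product Q Q' vanishes at 0 and at infinity.
  have hd : ∀ x ∈ Ici (0 : ℝ), HasDerivAt (fun x => soliton p x * solitonDeriv p x)
      (solitonDeriv p x ^ 2 + (soliton p x ^ 2 - (p + 1) / 2 * soliton p x ^ (p + 1))) x := by
    intro x _
    refine ((hasDerivAt_soliton hp x).mul (hasDerivAt_solitonDeriv hp x)).congr_deriv ?_
    have := soliton_pos p x
    field_simp
  have hlim : Filter.Tendsto (fun x => soliton p x * solitonDeriv p x) Filter.atTop (nhds 0) := by
    refine squeeze_zero_norm (a := soliton p) (fun x => ?_) (tendsto_soliton_atTop hp)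
    have h0 := soliton_pos p x
    have h1 : |solitonDeriv p x| ≤ 1 := by
      rw [← sq_le_one_iff_abs_le_one, solitonDeriv_sq hp]
      have h1 := soliton_le_one hp x
      have h2 := Real.rpow_nonneg h0.le (p + 1)
      nlinarith
    rw [Real.norm_eq_abs, abs_mul, abs_of_pos h0]
    exact mul_le_of_le_one_right h0.le h1
  have := integral_Ioi_of_hasDerivAt_of_tendsto' hd (iw.add (is.sub ir)) hlim
  rw [integral_add iw (by exact is.sub ir), integral_sub is ir, integral_const_mul] at this
  have h0 : solitonDeriv p 0 = 0 := by simp [solitonDeriv]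
  rw [h0, mul_zero, sub_zero] at this
  linarith

theorem integral_eq_two_mul_of_even {F : ℝ → ℝ} (hF : ∀ x, F (-x) = F x)
    (hi : IntegrableOn F (Ioi 0)) : Integrable F ∧ ∫ x, F x = 2 * ∫ x in Ioi 0, F x := by
  have h := integrable_of_Ioi_of_neg hi (by simpa only [hF] using hi)
  refine ⟨h, ?_⟩
  rw [integral_eq_Ioi_add_Ioi_neg h]
  simp only [hF]
  ring

theorem integrable_soliton_sq (hp : 1 < p) : Integrable fun x => soliton p x ^ 2 :=
  (integral_eq_two_mul_of_even (fun x => by simp) (integrableOn_soliton_sq hp)).1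

theorem integrable_soliton_rpow (hp : 1 < p) : Integrable fun x => soliton p x ^ (p + 1) :=
  (integral_eq_two_mul_of_even (fun x => by simp) (integrableOn_soliton_rpow hp)).1

theorem integrable_solitonDeriv_sq (hp : 1 < p) : Integrable fun x => solitonDeriv p x ^ 2 :=
  (integral_eq_two_mul_of_even (fun x => by simp) (integrableOn_solitonDeriv_sq hp)).1

/-- The soliton is an optimizer of the Gagliardo–Nirenberg inequality. -/
theorem sharpGN_le_of_soliton_le (hp : 1 < p) {C : ℝ≥0}
    (h : ENNReal.ofReal (∫ x, soliton p x ^ (p + 1)) ≤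
      C * ENNReal.ofReal (∫ x, soliton p x ^ 2) ^ ((p + 3) / 2 / 2) *
        ENNReal.ofReal (∫ x, solitonDeriv p x ^ 2) ^ ((p - 1) / 2 / 2)) : sharpGN p ≤ C := by
  rw [(integral_eq_two_mul_of_even (fun x => by simp) (integrableOn_soliton_sq hp)).2,
    (integral_eq_two_mul_of_even (fun x => by simp) (integrableOn_soliton_rpow hp)).2,
    (integral_eq_two_mul_of_even (fun x => by simp) (integrableOn_solitonDeriv_sq hp)).2] at h
  have hK := solitonAction_one_pos hp
  have h1 := integral_soliton_identity hp
  have h2 : ∫ x in Ioi 0, solitonDeriv p x ^ 2 =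
      (∫ x in Ioi 0, soliton p x ^ 2) - ∫ x in Ioi 0, soliton p x ^ (p + 1) := by
    simp only [solitonDeriv_sq hp]
    exact integral_sub (integrableOn_soliton_sq hp) (integrableOn_soliton_rpow hp)
  rw [integral_Ioi_solitonDeriv_sq hp] at h h1 h2
  set α := (p - 1) / 4 with hα
  have hα0 : 0 < α := by rw [hα]; linarith
  set D := 2 * solitonAction p 1 with hD
  have hD0 : 0 < D := by positivity
  -- The first integral and the Pohozaev identity are two linear relations, which express both
  -- remaining integrals through D.
  have hP : 2 * ∫ x in Ioi 0, soliton p x ^ (p + 1) = D / α := by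
    rw [eq_div_iff hα0.ne', hα, hD]; linarith
  have hA : 2 * ∫ x in Ioi 0, soliton p x ^ 2 = (1 + α) * (D / α) := by
    rw [add_mul, mul_div_cancel₀ D hα0.ne', ← hP, hD]; linarith
  have e1 : (p + 3) / 2 / 2 = 1 + α := by rw [hα]; ring
  have e2 : (p - 1) / 2 / 2 = α := by rw [hα]; ring
  rw [hA, hP, e1, e2, ENNReal.ofReal_rpow_of_nonneg (by positivity) (by positivity),
    ENNReal.ofReal_rpow_of_nonneg (by positivity) (by positivity), ← ENNReal.ofReal_coe_nnreal,
    ← ENNReal.ofReal_mul C.coe_nonneg, ← ENNReal.ofReal_mul (by positivity),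
    ENNReal.ofReal_le_ofReal_iff (by positivity), mul_assoc] at h
  have hE : 0 < ((1 + α) * (D / α)) ^ (1 + α) * D ^ α := by positivity
  refine le_of_mul_le_mul_right (le_of_eq_of_le ?_ h) hE
  rw [sharpGN, ← hα, ← hD, Real.mul_rpow (by positivity) (by positivity),
    Real.rpow_one_add' (by positivity : 0 ≤ D / α) (by positivity)]
  have h3 : (α / D ^ 2) ^ α * (D / α) ^ α * D ^ α = 1 := by
    rw [← Real.mul_rpow (by positivity) (by positivity),
      ← Real.mul_rpow (by positivity) (by positivity)]
    have : α / D ^ 2 * (D / α) * D = 1 := by field_simp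
    rw [this, Real.one_rpow]
  have h4 : (1 + α) ^ (1 + α) ≠ 0 := by positivity
  calc _ = (α / D ^ 2) ^ α * (D / α) ^ α * D ^ α * (D / α) *
        ((1 + α) ^ (1 + α) / (1 + α) ^ (1 + α)) := by ring
    _ = D / α := by rw [h3, div_self h4, one_mul, mul_one]

end soliton

/-! ### No smaller constant is admissible -/

section lower

open Filter Topology

variable {p : ℝ}

theorem hasWeakDeriv_soliton (hp : 1 < p) (I : Set ℝ) (s : ℝ) :
    HasWeakDeriv I (fun x => (soliton p (x + s) : ℂ)) (fun x => (solitonDeriv p (x + s) : ℂ)) :=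
  hasWeakDeriv_of_hasDerivAt I
    (fun x => ((hasDerivAt_soliton hp (x + s)).comp_add_const x s).ofReal_comp)
    (Complex.continuous_ofReal.comp ((continuous_solitonDeriv hp).comp (by fun_prop)))

theorem memLp_ofReal_comp_add {F : ℝ → ℝ} (hF : Continuous F) (h2 : Integrable fun x => F x ^ 2)
    (I : Set ℝ) (s : ℝ) : MemLp (fun x => (F (x + s) : ℂ)) 2 (volume.restrict I) :=
  ((((memLp_two_iff_integrable_sq hF.aestronglyMeasurable).2 h2).comp_measurePreserving
    (measurePreserving_add_right volume s)).ofReal (K := ℂ)).restrict I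

theorem memH1_soliton (hp : 1 < p) {I : Set ℝ} (s : ℝ) :
    MemH1 I fun x => (soliton p (x + s) : ℂ) :=
  ⟨memLp_ofReal_comp_add (continuous_soliton hp) (integrable_soliton_sq hp) I s, _,
    hasWeakDeriv_soliton hp I s,
    memLp_ofReal_comp_add (continuous_solitonDeriv hp) (integrable_solitonDeriv_sq hp) I s⟩

theorem sharpGN_le_of_mem_lineGNConstants (hp : 1 < p) {C : ℝ≥0} (hC : C ∈ lineGNConstants p) :
    sharpGN p ≤ C := by
  have h := hC _ (memH1_soliton hp 0)
  have hw := (hasWeakDeriv_soliton hp univ 0).weakDeriv_ae_eq isOpen_univ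
  have e : lineNorm univ 2 (weakDeriv univ fun x => (soliton p (x + 0) : ℂ)) =
      lineNorm univ 2 fun x => (solitonDeriv p (x + 0) : ℂ) := eLpNorm_congr_ae hw
  rw [e, lineNorm_rpow (by linarith), lineNorm_two_rpow, lineNorm_two_rpow] at h
  · refine sharpGN_le_of_soliton_le hp ?_
    simpa [abs_of_pos (soliton_pos p _)] using h
  · simpa using integrable_solitonDeriv_sq hp
  · simpa using integrable_soliton_sq hp
  · simpa [abs_of_pos (soliton_pos p _)] using integrable_soliton_rpow hp

theorem graphNorm_congr {N : ℕ} {q : ℝ} {f g : Fin N → ℝ → ℂ}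
    (h : ∀ k, f k =ᵐ[volume.restrict (Ioi 0)] g k) : graphNorm q f = graphNorm q g := by
  simp only [graphNorm, lineNorm, eLpNorm_congr_ae (h _)]

/-- The translations which move the profile towards the end of the edge `0`. -/
noncomputable def edgeShift {N : ℕ} [NeZero N] (L : ℝ) (k : Fin N) : ℝ := if k = 0 then -L else L

theorem integral_Ioi_comp_add (F : ℝ → ℝ) (s : ℝ) :
    ∫ x in Ioi 0, F (x + s) = ∫ x in Ioi s, F x := by
  have := (measurePreserving_add_right volume s).setIntegral_preimage_emb
    (measurableEmbedding_addRight s) F (Ioi s)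
  rwa [preimage_add_const_Ioi, sub_self] at this

/-- Edge 0 carries the integral over (−L, ∞), which exhausts the line; every other edge carries the
tail over (L, ∞). -/
theorem tendsto_sum_integral_edgeShift {N : ℕ} [NeZero N] {F : ℝ → ℝ} (hF : Integrable F) :
    Tendsto (fun L => ∑ k : Fin N, ∫ x in Ioi 0, F (x + edgeShift L k)) atTop (𝓝 (∫ x, F x)) := by
  have h0 : Tendsto (fun L : ℝ => ∫ x in Ioi (-L), F x) atTop (𝓝 (∫ x, F x)) :=
    (aecover_Ioi tendsto_neg_atTop_atBot).integral_tendsto_of_countably_generated hF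
  have h1 : Tendsto (fun L : ℝ => ∫ x in Ioi L, F x) atTop (𝓝 0) := by
    have h2 : Tendsto (fun L : ℝ => ∫ x in Iic L, F x) atTop (𝓝 (∫ x, F x)) :=
      (aecover_Iic tendsto_id).integral_tendsto_of_countably_generated hF
    have h3 := h2.const_sub (∫ x, F x)
    rw [sub_self] at h3
    refine h3.congr fun L => ?_
    rw [← intervalIntegral.integral_Iic_add_Ioi hF.integrableOn hF.integrableOn (b := L),
      add_sub_cancel_left]
  have h : ∀ k : Fin N, Tendsto (fun L => ∫ x in Ioi 0, F (x + edgeShift L k)) atTop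
      (𝓝 (if k = 0 then ∫ x, F x else 0)) := by
    intro k
    simp only [integral_Ioi_comp_add, edgeShift]
    split_ifs
    · exact h0
    · exact h1
  simpa using tendsto_finsetSum Finset.univ fun k _ => h k

/-- The shifted soliton is continuous at the vertex because Q is even: Q(−L) = Q(L) on all edges. In
the limit L → ∞ its inequality becomes that of the soliton on the line. -/
theorem sharpGN_le_of_mem_graphGNConstants {N : ℕ} [NeZero N] {γ : ℝ} (hp : 1 < p) {C : ℝ≥0}
    (hC : C ∈ graphGNConstants N γ p) : sharpGN p ≤ C := by
  set f : ℝ → Fin N → ℝ → ℂ := fun L k x => (soliton p (x + edgeShift L k) : ℂ) with hf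
  set g : ℝ → Fin N → ℝ → ℂ := fun L k x => (solitonDeriv p (x + edgeShift L k) : ℂ) with hg
  have hvertex : ∀ L k, f L k 0 = (soliton p L : ℂ) := by
    intro L k
    simp only [hf, edgeShift, zero_add]
    split_ifs <;> simp
  have hmem : ∀ L, MemH1c (f L) := fun L =>
    ⟨fun k => memH1_soliton hp _,
      fun k => (Complex.continuous_ofReal.comp
        ((continuous_soliton hp).comp (by fun_prop))).continuousOn,
      fun j k => by rw [hvertex, hvertex]⟩
  have hderiv : ∀ L, graphNorm 2 (graphDeriv (f L)) = graphNorm 2 (g L) := fun L =>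
    graphNorm_congr fun k => (hasWeakDeriv_soliton hp _ _).weakDeriv_ae_eq isOpen_Ioi
  have is := integrable_soliton_sq hp
  have ir := integrable_soliton_rpow hp
  have iw := integrable_solitonDeriv_sq hp
  have hineq : ∀ L, ENNReal.ofReal (∑ k : Fin N, ∫ x in Ioi 0,
        soliton p (x + edgeShift L k) ^ (p + 1)) ≤
      C * ENNReal.ofReal (∑ k : Fin N, ∫ x in Ioi 0,
        soliton p (x + edgeShift L k) ^ 2) ^ ((p + 3) / 2 / 2) *
      (ENNReal.ofReal (∑ k : Fin N, ∫ x in Ioi 0, solitonDeriv p (x + edgeShift L k) ^ 2) +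
        N * ENNReal.ofReal γ * ENNReal.ofReal (soliton p L) ^ (2 : ℝ)) ^ ((p - 1) / 2 / 2) := by
    intro L
    have h := hC (f L) (hmem L)
    rw [graphHdotNorm, hderiv, hvertex, graphNorm_rpow (by linarith), graphNorm_two_rpow,
      graphNorm_two_rpow, ← ENNReal.rpow_mul, one_div_mul_eq_div, ← ofReal_norm] at h
    · simpa [hf, hg, abs_of_pos (soliton_pos p _)] using h
    · intro k
      simpa [hg] using (iw.comp_add_right (edgeShift L k)).integrableOn
    · intro k
      simpa [hf] using (is.comp_add_right (edgeShift L k)).integrableOn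
    · intro k
      simpa [hf, abs_of_pos (soliton_pos p _)] using
        (ir.comp_add_right (edgeShift L k)).integrableOn
  have l1 := ENNReal.tendsto_ofReal (tendsto_sum_integral_edgeShift (N := N) ir)
  have l2 := (ENNReal.tendsto_ofReal (tendsto_sum_integral_edgeShift (N := N) is)).ennrpow_const
    ((p + 3) / 2 / 2)
  have l3 := ENNReal.tendsto_ofReal (tendsto_sum_integral_edgeShift (N := N) iw)
  -- The vertex term N γ Q(L)² disappears in the limit, so γ does not affect the constant.
  have l4 : Tendsto (fun L => N * ENNReal.ofReal γ * ENNReal.ofReal (soliton p L) ^ (2 : ℝ)) atTop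
      (𝓝 0) := by
    have h1 := (ENNReal.tendsto_ofReal (tendsto_soliton_atTop hp)).ennrpow_const 2
    rw [ENNReal.ofReal_zero, ENNReal.zero_rpow_of_pos two_pos] at h1
    have h2 := ENNReal.Tendsto.const_mul (a := N * ENNReal.ofReal γ) h1
      (Or.inr (ENNReal.mul_ne_top (ENNReal.natCast_ne_top N) ENNReal.ofReal_ne_top))
    rwa [mul_zero] at h2
  have l5 := (l3.add l4).ennrpow_const ((p - 1) / 2 / 2)
  rw [add_zero] at l5
  have t1 : ENNReal.ofReal (∫ x, soliton p x ^ 2) ^ ((p + 3) / 2 / 2) ≠ ⊤ :=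
    ENNReal.rpow_ne_top_of_nonneg (by linarith) ENNReal.ofReal_ne_top
  have t2 : ENNReal.ofReal (∫ x, solitonDeriv p x ^ 2) ^ ((p - 1) / 2 / 2) ≠ ⊤ :=
    ENNReal.rpow_ne_top_of_nonneg (by linarith) ENNReal.ofReal_ne_top
  have l6 := ENNReal.Tendsto.mul (ENNReal.Tendsto.const_mul (a := C) l2
    (Or.inr ENNReal.coe_ne_top)) (Or.inr t2) l5 (Or.inr (ENNReal.mul_ne_top ENNReal.coe_ne_top t1))
  exact sharpGN_le_of_soliton_le hp (le_of_tendsto_of_tendsto' l1 l6 hineq)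

/-- Two edges are enough for the second route to infinity. -/
theorem graphGNConstants_eq {N : ℕ} [NeZero N] (hN : 2 ≤ N) (hp : 1 < p) (γ : ℝ) :
    graphGNConstants N γ p = Ici (sharpGN p).toNNReal :=
  Set.ext fun _ => ⟨fun h => Real.toNNReal_le_iff_le_coe.2 (sharpGN_le_of_mem_graphGNConstants hp h),
    fun h => mem_graphGNConstants hN hp γ (Real.toNNReal_le_iff_le_coe.1 h)⟩

theorem lineGNConstants_eq (hp : 1 < p) :
    lineGNConstants p = Ici (sharpGN p).toNNReal :=
  Set.ext fun _ => ⟨fun h => Real.toNNReal_le_iff_le_coe.2 (sharpGN_le_of_mem_lineGNConstants hp h),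
    fun h => mem_lineGNConstants hp (Real.toNNReal_le_iff_le_coe.1 h)⟩

end lower

/-- The best Gagliardo–Nirenberg constants on the star graph and on the real line exist (finite
constants with which the inequalities hold, and least such) and are equal. -/
theorem lemma2p2 (N : ℕ) [NeZero N] (hN : 3 ≤ N) (p γ : ℝ) (hp : 1 < p) (hγ : 0 ≤ γ) :
    IsLeast (graphGNConstants N γ p) (graphGN N γ p) ∧
      IsLeast (lineGNConstants p) (lineGN p) ∧
      graphGN N γ p = lineGN p := by
  rw [graphGN, lineGN, graphGNConstants_eq (by omega) hp γ, lineGNConstants_eq hp, csInf_Ici]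
  exact ⟨isLeast_Ici, isLeast_Ici, rfl⟩
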